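/- Let $\Sigma=S^1\times(-1,1)$ ($S^1=\mathbb R/T\mathbb Z$, $T>0$) with coordinates $(q,p)$, $\lambda=p\,dq$, $\omega=dq\wedge dp=-d\lambda$, and let $L_0=S^1\times\{0\}$, oriented by increasing $q$. Let $L$ be the image of $L_0$ under a compactly supported Hamiltonian diffeomorphism of $\Sigma$, and suppose that $L$ meets $L_0$ transversely in $2n$ points $s_1,\dots,s_{2n}$, numbered in their cyclic order on $L_0$ ($s_{i+2n}=s_i$). A marking of a curve $K$ is a function $h_K:K\to\mathbb R$ with $dh_K=\lambda|_K$. For markings $h_{L_0},h_L$ the action of $x\in L_0\cap L$ is $\mathcal A(x)=h_{L_0}(x)-h_L(x)$. The graph $T(L)$ has as vertices the connected components of $\Sigma\setminus(L_0\cup L)$, weighted by area $a(\cdot)$. For each $i\in\{1,\dots,2n\}$ it has an edge $i$, which joins the region above to the region below the open segment $(s_i,s_{i+1})$ of $L_0$ and is oriented from the former to the latter. The roots are the two regions that reach an end of $\Sigma$. A leaf is a vertex other than a root with exactly one edge. Let $v$ be a leaf with edge $j$, and let $w$ be a vertex at distance $2$ from $v$; let $k$ be the edge at $w$ on the path from $w$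 to $v$. Number the points so that $1\le j$ and $j+2\le k\le 2n$. Let $\varepsilon>0$ and let $\phi$ be a compactly supported Hamiltonian diffeomorphism of $\Sigma$ that deletes the leaf $v$ and moves the area $a(v)+\varepsilon$ to $w$. This means that $L'=\phi(L)$ has the following properties: * $L'$ is transverse to $L_0$, and $L_0\cap L'=(L_0\cap L)\setminus\{s_j,s_{j+1}\}$; * every point of $L_0$ that $\phi$ moves lies in one of the open segments $(s_{j-1},s_{j+2})$, $(s_k,s_{k+1})$ of $L_0$ (so $\phi$ fixes the remaining intersection points); * $T(L')$ is obtained from $T(L)$ by removing $v$ with its edge, and by merging the two regions that lie across $L_0$ from $v$'s side at the segments $j-1$ and $j+1$, so that the edges $j-1$ and $j+1$ become one edge; all other incidences, the orientations and the roots are kept; * the region of $T(L')$ that corresponds to $w$ has area $a(w)+a(v)+\varepsilon$. Let $\mathcal A$ and $\mathcal A'$ be the actions of $(L_0,L)$ and $(L_0,L')$ for any choice of markings. Then, after adding a constant to $\mathcal A'$, the following holds for all $l\in\{1,\dots,2n\}\setminus\{j,j+1\}$. Case 1: if $v$ lies above $L_0$ (in $\{p>0\}$), then $$\mathcal A'(s_l)=\begin{cases}\mathcal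 A(s_l)+\frac{a(v)+\varepsilon}{2}& j+2\le l\le k,\\ \mathcal A(s_l)-\frac{a(v)+\varepsilon}{2}&\text{otherwise.}\end{cases}$$ Case 2: if $v$ lies below $L_0$ (in $\{p<0\}$), then $$\mathcal A'(s_l)=\begin{cases}\mathcal A(s_l)-\frac{a(v)+\varepsilon}{2}& j+2\le l\le k,\\ \mathcal A(s_l)+\frac{a(v)+\varepsilon}{2}&\text{otherwise.}\end{cases}$$ -/

import Mathlib

open scoped ContDiff

namespace Cylinder

/-- The cylinder `S¹ × ℝ`, where `S¹ = ℝ / Tℤ`, with coordinates `(q, p)`. -/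
abbrev Cyl (T : ℝ) : Type := AddCircle T × ℝ

/-- The universal covering `(q, p) ↦ (q mod T, p)`. -/
def proj (T : ℝ) (z : ℝ × ℝ) : Cyl T := ((z.1 : AddCircle T), z.2)

/-- The open annulus `Σ = S¹ × (-1, 1)`, as an open subset of `S¹ × ℝ`. -/
def annulus (T : ℝ) : Set (Cyl T) := {x | |x.2| < 1}

/-- The zero section `L₀ = S¹ × {0}`. -/
def zeroSection (T : ℝ) : Set (Cyl T) := {x | x.2 = 0}

/-- The point `(q, 0)` of the zero section. -/
def pt (T : ℝ) (q : ℝ) : Cyl T := proj T (q, 0)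

/-- The Hamiltonian vector field of `h(q, p)` for `ω = dq ∧ dp`, that is `ω(X, -) = -dh`:
`X = (-∂h/∂p, ∂h/∂q)`. -/
noncomputable def hamField (h : ℝ × ℝ → ℝ) (z : ℝ × ℝ) : ℝ × ℝ :=
  (-(fderiv ℝ h z (0, 1)), fderiv ℝ h z (1, 0))

/-- `φ` is a compactly supported Hamiltonian diffeomorphism of `Σ` (extended by the identity to
`S¹ × ℝ`): the time-one map of the flow of a smooth time-dependent Hamiltonian `H` whose support
lies in `S¹ × [-c, c]` for some `c < 1`. The flow is written on the universal covering. -/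
def IsHamDiffeo {T : ℝ} (φ : Cyl T → Cyl T) : Prop :=
  ∃ (H : ℝ → Cyl T → ℝ) (Φ : ℝ → ℝ × ℝ → ℝ × ℝ),
    ContDiff ℝ ∞ (fun x : ℝ × (ℝ × ℝ) => H x.1 (proj T x.2)) ∧
    (∃ c : ℝ, c < 1 ∧ ∀ t x, c < |x.2| → H t x = 0) ∧
    ContDiff ℝ ∞ (fun x : ℝ × (ℝ × ℝ) => Φ x.1 x.2) ∧
    (∀ z, Φ 0 z = z) ∧
    (∀ t z, HasDerivAt (fun τ => Φ τ z) (hamField (fun y => H t (proj T y)) (Φ t z)) t) ∧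
    (∀ z, φ (proj T z) = proj T (Φ 1 z))

/-- `L ∈ 𝓛(L₀)`: the curve `L` is Hamiltonian isotopic to the zero section. -/
def IsHamIsotopic {T : ℝ} (L : Set (Cyl T)) : Prop :=
  ∃ ψ : Cyl T → Cyl T, IsHamDiffeo ψ ∧ ψ '' zeroSection T = L

/-- The lift to the universal covering of a smooth path in `L`. -/
def IsSmoothPathIn {T : ℝ} (L : Set (Cyl T)) (γ : ℝ → ℝ × ℝ) : Prop :=
  ContDiff ℝ ∞ γ ∧ ∀ t, proj T (γ t) ∈ L

/-- The vectors tangent to `L` at (the point covered by) `z`. -/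
def tangentVectors {T : ℝ} (L : Set (Cyl T)) (z : ℝ × ℝ) : Set (ℝ × ℝ) :=
  {u | ∃ γ, IsSmoothPathIn L γ ∧ γ 0 = z ∧ deriv γ 0 = u}

/-- `L` and `M` intersect transversely: the tangent spaces span at every common point. -/
def Transverse {T : ℝ} (L M : Set (Cyl T)) : Prop :=
  ∀ z, proj T z ∈ L ∩ M → Submodule.span ℝ (tangentVectors L z ∪ tangentVectors M z) = ⊤

/-- `h` (of which only the values on `L` matter) is a marking of `L`, that is a primitive of
`λ|_L` for `λ = p dq`. -/
def IsMarking {T : ℝ} (L : Set (Cyl T)) (h : Cyl T → ℝ) : Prop :=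
  ∀ γ, IsSmoothPathIn L γ →
    ∀ t, HasDerivAt (fun τ => h (proj T (γ τ))) ((γ t).2 * (deriv γ t).1) t

/-- The action functional of a pair `(L, M)` with markings `hL`, `hM`, at (the constant path at)
an intersection point `x`. The sign is such that a smooth lune from `x` to `y`, which follows `L`
from `x` to `y` and comes back along `M`, has area `action x - action y`. -/
def action {T : ℝ} (hL hM : Cyl T → ℝ) (x : Cyl T) : ℝ := hL x - hM x

/-- `L₀ ∩ L` consists of `2n` points, and `s` lists their `q`-coordinates in the order in which
they lie on `L₀`, cyclically: index `i + 2n` denotes the same point as `i`. -/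
structure IsEnumeration {T : ℝ} (L : Set (Cyl T)) (n : ℕ) (s : ℤ → ℝ) : Prop where
  strictMono : StrictMono s
  periodic : ∀ i, s (i + 2 * n) = s i + T
  range_eq : Set.range (fun i => pt T (s i)) = zeroSection T ∩ L

/-! ### The graph `T(L)` -/

/-- The vertices of `T(L)`: the connected components of `Σ \ (L₀ ∪ L)`. -/
def regions {T : ℝ} (L : Set (Cyl T)) : Set (Set (Cyl T)) :=
  {R | ∃ x ∈ annulus T \ (zeroSection T ∪ L),
    R = connectedComponentIn (annulus T \ (zeroSection T ∪ L)) x}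

/-- The weight of a vertex: the area of the region. -/
noncomputable def area {T : ℝ} [Fact (0 < T)] (R : Set (Cyl T)) : ℝ :=
  (MeasureTheory.volume R).toReal

/-- The roots: the regions that reach an end of `Σ`. -/
def IsRoot {T : ℝ} (R : Set (Cyl T)) : Prop := ∀ c : ℝ, c < 1 → ∃ x ∈ R, c < |x.2|

/-- The open segment of `L₀` between the consecutive points `s i` and `s (i + 1)`. -/
def segment (T : ℝ) (s : ℤ → ℝ) (i : ℤ) : Set (Cyl T) := pt T '' Set.Ioo (s i) (s (i + 1))

/-- The oriented edge of `T(L)` at the segment `i`: it points from the region `R` above `L₀` to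
the region `R'` below `L₀` that have this segment in their common boundary. -/
def IsEdge {T : ℝ} (L : Set (Cyl T)) (s : ℤ → ℝ) (i : ℤ) (R R' : Set (Cyl T)) : Prop :=
  R ∈ regions L ∧ R' ∈ regions L ∧ (∀ x ∈ R, 0 < x.2) ∧ (∀ x ∈ R', x.2 < 0) ∧
    segment T s i ⊆ closure R ∧ segment T s i ⊆ closure R'

/-- Case 1: the leaf lies above `L₀`. Case 2: it lies below `L₀`. -/
inductive Side
  | above
  | below

/-- The edge at the segment `i` joins `R`, on the given side of `L₀`, to `R'` on the other
side. -/
def Joins {T : ℝ} (L : Set (Cyl T)) (s : ℤ → ℝ) : Side → ℤ → Set (Cyl T) → Set (Cyl T) → Prop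
  | Side.above, i, R, R' => IsEdge L s i R R'
  | Side.below, i, R, R' => IsEdge L s i R' R

/-- `v` is a leaf of `T(L)`, different from the roots, on the given side of `L₀`, and its only
edge is the one at the segment `j`. -/
structure IsLeaf {T : ℝ} (L : Set (Cyl T)) (n : ℕ) (s : ℤ → ℝ) (side : Side) (j : ℤ)
    (v : Set (Cyl T)) : Prop where
  edge : ∃ a, Joins L s side j v a
  unique : ∀ i a, Joins L s side i v a → i ≡ j [ZMOD 2 * n]
  not_root : ¬ IsRoot v

/-- The graph `T(L')` arises from `T(L)` by removing the leaf `v`. The regions `b₁`, `b₂` across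
`L₀` at the segments `j - 1` and `j + 1` next to `v` become one region, so that the edges `j - 1`
and `j + 1`, which join them to the same region `b`, become one edge. Nothing else changes in the
(rooted, oriented, ordered) graph. The map `F` sends every region other than `v` to the
corresponding region for `L'`. -/
structure RemovesLeaf {T : ℝ} (L L' : Set (Cyl T)) (n : ℕ) (s : ℤ → ℝ) (side : Side) (j : ℤ)
    (v : Set (Cyl T)) (F : Set (Cyl T) → Set (Cyl T)) : Prop where
  mapsTo : Set.MapsTo F (regions L \ {v}) (regions L')
  surjOn : Set.SurjOn F (regions L \ {v}) (regions L')
  merge : ∃ b b₁ b₂, Joins L s side (j - 1) b b₁ ∧ Joins L s side (j + 1) b b₂ ∧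
    ∀ R ∈ regions L \ {v}, ∀ R' ∈ regions L \ {v},
      (F R = F R' ↔ R = R' ∨ (R = b₁ ∧ R' = b₂) ∨ (R = b₂ ∧ R' = b₁))
  edges : ∀ i, ¬ i ≡ j [ZMOD 2 * n] → ∀ R R', IsEdge L s i R R' → IsEdge L' s i (F R) (F R')
  roots : ∀ R ∈ regions L \ {v}, IsRoot R → IsRoot (F R)

/-- The Hamiltonian diffeomorphism `φ` deletes the leaf `v` with edge `j` from `T(L)` and moves
the area `a(v) + ε` to the vertex `w` at distance two from `v`, where `k` is the edge at `w` on
the path from `w` to `v`. -/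
structure IsLeafDeletion {T : ℝ} [Fact (0 < T)] (L : Set (Cyl T)) (n : ℕ) (s : ℤ → ℝ)
    (side : Side) (j k : ℤ) (v w : Set (Cyl T)) (ε : ℝ) (φ : Cyl T → Cyl T) : Prop where
  isHamDiffeo : IsHamDiffeo φ
  isLeaf : IsLeaf L n s side j v
  /-- the path `v, a, w` in `T(L)` -/
  path : ∃ a, Joins L s side j v a ∧ Joins L s side k w a
  transverse : Transverse (zeroSection T) (φ '' L)
  inter_eq : zeroSection T ∩ φ '' L = (zeroSection T ∩ L) \ {pt T (s j), pt T (s (j + 1))}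
  /-- on `L₀`, the support of `φ` is confined to the neighbourhood of the leaf and the edge `k` -/
  support : ∀ q : ℝ, φ (pt T q) ≠ pt T q →
    pt T q ∈ pt T '' (Set.Ioo (s (j - 1)) (s (j + 2)) ∪ Set.Ioo (s k) (s (k + 1)))
  /-- the graph loses the leaf and the weight of `w` grows by `a(v) + ε` -/
  graph : ∃ F, RemovesLeaf L (φ '' L) n s side j v F ∧ area (F w) = area w + (area v + ε)

end Cylinder

open Cylinder

open scoped ContDiff
namespace Cylinder

open Set Filter Topology MeasureTheory

/-! Write `L = ψ(L₀)` and lift `ψ⁻¹` to a map `Ψ = (Q, ρ)` of the universal covering. Being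
Hamiltonian, it changes `λ` by an exact form, `Ψ^*λ - λ = d prim`. Since `ρ = 0` on `L`, the form
`Ψ^*λ = ρ dQ` vanishes on `L`, so `h_L = -prim + const` there. As `λ` also vanishes on `L₀`, the
action of an intersection point is the value of `prim`, up to a common constant
(`exists_action_eq`).

The same form measures areas: `-ρ dQ` is a primitive of `ω` that vanishes on `L`. By Stokes, the
area of a region is a sum over the segments of `L₀` on its boundary, plus `T` if it is a root
(`area_eq`). On `L₀` one has `ρ dQ = d prim`, so a segment contributes, up to the sign of the side,
the difference of `prim` at its end points.

For `L' = φ(L)` take `Ψ' = Ψ ∘ φ⁻¹` and let `D i` be the difference of the two primitives at `s i`.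
On a segment fixed by `φ` the two forms agree, so `D` can jump only across the segment `k` and
across those next to the leaf. The region `w` keeps its segments and its root status. It does not
touch the segments `j - 1`, `j`, `j + 1`: it lies on the same side of `L` as `v`, whereas the region
at `j ± 1` lies on the other side (`ne_of_path`). Hence the growth `a(v) + ε` of the area of `w` is,
up to sign, the jump of `D` across `k` (`IsLeafDeletion.exists_prim_jump`). So `D` takes one value
on `j + 2, …, k` and another on the remaining points; subtracting their mean leaves `±(a(v) + ε)/2`.
-/

/-! ### Uniqueness for flows and integrals with a parameter. -/

theorem eq_of_hasDerivAt_of_contDiff {E : Type*} [NormedAddCommGroup E] [NormedSpace ℝ E]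
    [ProperSpace E] {V : ℝ × E → E} (hV : ContDiff ℝ 1 V) {α β : ℝ → E} {t₀ : ℝ}
    (hα : ∀ t, HasDerivAt α (V (t, α t)) t) (hβ : ∀ t, HasDerivAt β (V (t, β t)) t)
    (h : α t₀ = β t₀) : α = β := by
  ext t
  set a := min t t₀ - 1
  set b := max t t₀ + 1
  have hta : t ∈ Icc a b := ⟨by grind, by grind⟩
  have ht₀ : t₀ ∈ Ioo a b := ⟨by grind, by grind⟩
  have cα : Continuous α := continuous_iff_continuousAt.2 fun t => (hα t).continuousAt
  have cβ : Continuous β := continuous_iff_continuousAt.2 fun t => (hβ t).continuousAt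
  -- `V` is only locally Lipschitz, but on a compact time interval both solutions stay in one ball,
  -- over which the derivative of `V` is bounded.
  obtain ⟨M, hM⟩ := (isCompact_Icc (a := a) (b := b)).exists_bound_of_continuousOn cα.continuousOn
  obtain ⟨N, hN⟩ := (isCompact_Icc (a := a) (b := b)).exists_bound_of_continuousOn cβ.continuousOn
  set S : Set E := Metric.closedBall 0 (max M N)
  obtain ⟨K, hK⟩ := ((isCompact_Icc (a := a) (b := b)).prod
    (isCompact_closedBall (0 : E) (max M N))).exists_bound_of_continuousOn
    (hV.continuous_fderiv one_ne_zero).continuousOn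
  have hL : ∀ t ∈ Ioo a b, LipschitzOnWith K.toNNReal (fun x => V (t, x)) S := by
    intro t ht
    have h1 : LipschitzOnWith K.toNNReal V (Icc a b ×ˢ S) := by
      refine Convex.lipschitzOnWith_of_nnnorm_fderiv_le (𝕜 := ℝ)
        (fun x _ => (hV.differentiable one_ne_zero) x) (fun x hx => ?_)
        ((convex_Icc a b).prod (convex_closedBall _ _))
      exact NNReal.coe_le_coe.1 ((hK x hx).trans (Real.le_coe_toNNReal K))
    intro x hx y hy
    have := h1 (x := (t, x)) ⟨Ioo_subset_Icc_self ht, hx⟩ (y := (t, y))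
      ⟨Ioo_subset_Icc_self ht, hy⟩
    simpa [Prod.edist_eq] using this
  refine ODE_solution_unique_of_mem_Icc (v := fun t x => V (t, x)) (s := fun _ => S) hL ht₀
    cα.continuousOn (fun t _ => hα t) (fun t ht => ?_) cβ.continuousOn (fun t _ => hβ t)
    (fun t ht => ?_) h hta
  · exact mem_closedBall_zero_iff.2 ((hM t (Ioo_subset_Icc_self ht)).trans (le_max_left _ _))
  · exact mem_closedBall_zero_iff.2 ((hN t (Ioo_subset_Icc_self ht)).trans (le_max_right _ _))

theorem hasFDerivAt_intervalIntegral_of_contDiff {E : Type*} [NormedAddCommGroup E]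
    [NormedSpace ℝ E] [ProperSpace E] {g : ℝ × E → ℝ} (hg : ContDiff ℝ 1 g) (a b : ℝ) (z : E) :
    HasFDerivAt (fun z => ∫ t in a..b, g (t, z))
      (∫ t in a..b, (fderiv ℝ g (t, z)).comp (ContinuousLinearMap.inr ℝ ℝ E)) z := by
  have cg : Continuous fun x => fderiv ℝ g x := hg.continuous_fderiv one_ne_zero
  obtain ⟨K, hK⟩ := ((isCompact_uIcc (a := a) (b := b)).prod
    (isCompact_closedBall z 1)).exists_bound_of_continuousOn
    (f := fun x => (fderiv ℝ g x).comp (ContinuousLinearMap.inr ℝ ℝ E))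
    (by fun_prop)
  refine intervalIntegral.hasFDerivAt_integral_of_dominated_of_fderiv_le
    (F' := fun z t => (fderiv ℝ g (t, z)).comp (ContinuousLinearMap.inr ℝ ℝ E))
    (bound := fun _ => K) (Metric.closedBall_mem_nhds z one_pos) ?_ ?_ ?_ ?_ ?_ ?_
  · refine Eventually.of_forall fun x => Continuous.aestronglyMeasurable ?_
    exact hg.continuous.comp (by fun_prop)
  · refine Continuous.intervalIntegrable ?_ _ _
    exact hg.continuous.comp (by fun_prop)
  · have : SecondCountableTopologyEither ℝ (E →L[ℝ] ℝ) := secondCountableTopologyEither_of_left _ _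
    have h1 : Continuous fun t : ℝ => fderiv ℝ g (t, z) := cg.comp (by fun_prop)
    exact (h1.clm_comp continuous_const).aestronglyMeasurable
  · exact Eventually.of_forall fun t ht x hx => hK (t, x) ⟨uIoc_subset_uIcc ht, hx⟩
  · simp
  · refine Eventually.of_forall fun t _ x _ => ?_
    have h1 := ((hg.differentiable one_ne_zero) (t, x)).hasFDerivAt
    exact h1.comp x (hasFDerivAt_prodMk_right t x)

/-! ### Exactness and area preservation of Hamiltonian maps. -/

/-- The one-form `λ = p dq` pulled back along a map `f`. -/
noncomputable def pullback (f : ℝ × ℝ → ℝ × ℝ) (z : ℝ × ℝ) : ℝ × ℝ →L[ℝ] ℝ :=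
  (f z).2 • (ContinuousLinearMap.fst ℝ ℝ ℝ).comp (fderiv ℝ f z)

theorem hasDerivAt_fderiv_apply {E : Type*} [NormedAddCommGroup E] [NormedSpace ℝ E]
    {Q : ℝ × E → ℝ} (hQ : ContDiff ℝ 2 Q) (t : ℝ) (z e : E) :
    HasDerivAt (fun τ => fderiv ℝ Q (τ, z) (0, e))
      (fderiv ℝ (fun x => fderiv ℝ Q x (1, 0)) (t, z) (0, e)) t := by
  have h1 : ContDiff ℝ 1 (fderiv ℝ Q) := hQ.fderiv_right (by norm_num)
  have h2 : HasFDerivAt (fderiv ℝ Q) (fderiv ℝ (fderiv ℝ Q) (t, z)) (t, z) :=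
    ((h1.differentiable one_ne_zero) _).hasFDerivAt
  have h3 : HasDerivAt (fun τ : ℝ => (τ, z)) ((1 : ℝ), (0 : E)) t :=
    (hasDerivAt_id t).prodMk (hasDerivAt_const t z)
  have h4 : HasDerivAt (fun τ => fderiv ℝ Q (τ, z)) (fderiv ℝ (fderiv ℝ Q) (t, z) (1, 0)) t :=
    h2.comp_hasDerivAt t h3
  have h5 : HasDerivAt (fun τ => fderiv ℝ Q (τ, z) (0, e))
      (fderiv ℝ (fderiv ℝ Q) (t, z) (1, 0) (0, e)) t := by
    simpa using h4.clm_apply (hasDerivAt_const t ((0 : ℝ), e))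
  have h6 : fderiv ℝ (fun x => fderiv ℝ Q x (1, 0)) (t, z) (0, e)
      = fderiv ℝ (fderiv ℝ Q) (t, z) (0, e) (1, 0) := by
    rw [(h2.clm_apply (hasFDerivAt_const ((1 : ℝ), (0 : E)) (t, z))).fderiv]
    simp
  rw [h6, second_derivative_symmetric
    (fun y => ((hQ.differentiable two_ne_zero) y).hasFDerivAt) h2]
  exact h5

/-- A Hamiltonian flow changes `λ = p dq` by an exact form. -/
theorem exists_prim_of_flow {K : ℝ × (ℝ × ℝ) → ℝ} (hK : ContDiff ℝ 2 K)
    {B : ℝ × (ℝ × ℝ) → ℝ × ℝ} (hB : ContDiff ℝ 2 B) (h0 : ∀ z, B (0, z) = z)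
    (hd : ∀ t z, HasDerivAt (fun τ => B (τ, z)) (hamField (fun y => K (t, y)) (B (t, z))) t) :
    ∃ F : ℝ × ℝ → ℝ, ∀ z, HasFDerivAt F
      (pullback (fun z => B (1, z)) z - z.2 • ContinuousLinearMap.fst ℝ ℝ ℝ) z := by
  set Q : ℝ × (ℝ × ℝ) → ℝ := fun x => (B x).1 with hQd
  set P : ℝ × (ℝ × ℝ) → ℝ := fun x => (B x).2 with hPd
  have hQ : ContDiff ℝ 2 Q := contDiff_fst.comp hB
  have hP : ContDiff ℝ 2 P := contDiff_snd.comp hB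
  have hQt : ContDiff ℝ 1 (fun x => fderiv ℝ Q x (1, 0)) :=
    (hQ.fderiv_right (m := 1) (by norm_num)).clm_apply contDiff_const
  -- By Cartan's formula the Lie derivative of `λ` along the Hamiltonian field `X` is the
  -- differential of `K + λ(X)`. Here `g` is that function transported by the flow, and its integral
  -- over time is the primitive; `key` is the formula evaluated on a vector `e`.
  set g : ℝ × (ℝ × ℝ) → ℝ := fun x => K (x.1, B x) + P x * fderiv ℝ Q x (1, 0) with hgd
  have hg : ContDiff ℝ 1 g :=
    ((hK.of_le (by norm_num)).comp (contDiff_fst.prodMk (hB.of_le (by norm_num)))).add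
      ((hP.of_le (by norm_num)).mul hQt)
  have line : ∀ t (z : ℝ × ℝ), HasDerivAt (fun τ : ℝ => (τ, z)) ((1 : ℝ), (0 : ℝ × ℝ)) t :=
    fun t z => (hasDerivAt_id t).prodMk (hasDerivAt_const t z)
  have dQ : ∀ x, HasFDerivAt Q (fderiv ℝ Q x) x := fun x =>
    ((hQ.differentiable two_ne_zero) x).hasFDerivAt
  have dP : ∀ x, HasFDerivAt P (fderiv ℝ P x) x := fun x =>
    ((hP.differentiable two_ne_zero) x).hasFDerivAt
  have dB : ∀ x, HasFDerivAt B ((fderiv ℝ Q x).prod (fderiv ℝ P x)) x := fun x =>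
    (dQ x).prodMk (dP x)
  have dK : ∀ x, HasFDerivAt K (fderiv ℝ K x) x := fun x =>
    ((hK.differentiable two_ne_zero) x).hasFDerivAt
  have hKs : ∀ t z, fderiv ℝ (fun y => K (t, y)) z
      = (fderiv ℝ K (t, z)).comp (ContinuousLinearMap.inr ℝ ℝ (ℝ × ℝ)) := fun t z =>
    ((dK (t, z)).comp z (hasFDerivAt_prodMk_right t z)).fderiv
  have ham : ∀ t z, fderiv ℝ Q (t, z) (1, 0) = -fderiv ℝ K (t, B (t, z)) (0, (0, 1)) ∧
      fderiv ℝ P (t, z) (1, 0) = fderiv ℝ K (t, B (t, z)) (0, (1, 0)) := by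
    intro t z
    have h1 := (dB (t, z)).comp_hasDerivAt t (line t z)
    have h2 := h1.unique (hd t z)
    simp only [hamField, hKs, ContinuousLinearMap.prod_apply] at h2
    simpa [Prod.ext_iff] using h2
  have key : ∀ t z e, HasDerivAt (fun τ => P (τ, z) * fderiv ℝ Q (τ, z) (0, e))
      (fderiv ℝ g (t, z) (0, e)) t := by
    intro t z e
    have h1 : HasDerivAt (fun τ => P (τ, z) * fderiv ℝ Q (τ, z) (0, e))
        (fderiv ℝ P (t, z) (1, 0) * fderiv ℝ Q (t, z) (0, e)
          + P (t, z) * fderiv ℝ (fun x => fderiv ℝ Q x (1, 0)) (t, z) (0, e)) t :=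
      ((dP (t, z)).comp_hasDerivAt t (line t z)).mul (hasDerivAt_fderiv_apply hQ t z e)
    have h2 : HasFDerivAt g _ (t, z) :=
      ((dK (t, B (t, z))).comp (t, z) ((hasFDerivAt_fst (p := (t, z))).prodMk (dB (t, z)))).add
        ((dP (t, z)).mul ((hQt.differentiable one_ne_zero) (t, z)).hasFDerivAt)
    rw [h2.fderiv]
    refine h1.congr_deriv ?_
    have hlin : ∀ u v : ℝ, fderiv ℝ K (t, B (t, z)) (0, (u, v)) =
        fderiv ℝ P (t, z) (1, 0) * u - fderiv ℝ Q (t, z) (1, 0) * v := by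
      intro u v
      rw [(ham t z).1, (ham t z).2]
      have : ((0 : ℝ), (u, v)) = u • ((0 : ℝ), ((1 : ℝ), (0 : ℝ)))
          + v • ((0 : ℝ), ((0 : ℝ), (1 : ℝ))) := by simp
      rw [this, map_add, map_smul, map_smul]
      simp; ring
    simp only [add_apply, smul_apply, ContinuousLinearMap.comp_apply,
      ContinuousLinearMap.prod_apply, smul_eq_mul, ContinuousLinearMap.coe_fst']
    rw [hlin]
    ring
  refine ⟨fun z => ∫ t in (0 : ℝ)..1, g (t, z), fun z => ?_⟩
  refine (hasFDerivAt_intervalIntegral_of_contDiff hg 0 1 z).congr_fderiv ?_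
  refine ContinuousLinearMap.ext fun e => ?_
  have cg : Continuous fun x => fderiv ℝ g x := hg.continuous_fderiv one_ne_zero
  have cgz : Continuous fun t : ℝ => fderiv ℝ g (t, z) := cg.comp (by fun_prop)
  rw [ContinuousLinearMap.intervalIntegral_apply
    ((cgz.clm_comp continuous_const).intervalIntegrable _ _)]
  have hB1 : HasFDerivAt (fun z => B (1, z)) _ z :=
    (dB (1, z)).comp z (hasFDerivAt_prodMk_right (1 : ℝ) z)
  have hB0 : fderiv ℝ Q (0, z) (0, e) = e.1 := by
    have h1 := (dQ (0, z)).comp z (hasFDerivAt_prodMk_right (0 : ℝ) z)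
    have h2 : Q ∘ (fun z => ((0 : ℝ), z)) = Prod.fst := by ext z; simp [hQd, h0]
    rw [h2] at h1
    have := congrArg (fun l => l e) (h1.unique hasFDerivAt_fst)
    simpa using this
  have h1 := intervalIntegral.integral_eq_sub_of_hasDerivAt (a := 0) (b := 1)
    (fun t _ => key t z e) ((cgz.clm_apply continuous_const).intervalIntegrable _ _)
  simp only [ContinuousLinearMap.comp_apply, ContinuousLinearMap.inr_apply]
  rw [h1, hB0]
  simp [pullback, hB1.fderiv, hPd, h0]

/-- A diffeomorphism of the universal covering that commutes with the deck transformations, is the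
identity near the two ends and changes `λ = p dq` by the differential of `prim`. -/
structure ExactLift (T : ℝ) where
  toFun : ℝ × ℝ → ℝ × ℝ
  invFun : ℝ × ℝ → ℝ × ℝ
  prim : ℝ × ℝ → ℝ
  contDiff_toFun : ContDiff ℝ ∞ toFun
  contDiff_invFun : ContDiff ℝ ∞ invFun
  left_inv : ∀ z, invFun (toFun z) = z
  right_inv : ∀ z, toFun (invFun z) = z
  equivariant : ∀ z, toFun (z + (T, 0)) = toFun z + (T, 0)
  hasFDerivAt_prim : ∀ z,
    HasFDerivAt prim (pullback toFun z - z.2 • ContinuousLinearMap.fst ℝ ℝ ℝ) z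
  eq_self : ∃ c : ℝ, 0 ≤ c ∧ c < 1 ∧ ∀ z : ℝ × ℝ, c < |z.2| → toFun z = z

/-- An exact form has a symmetric derivative, so `f^*λ - λ` is closed. The second derivatives of `f`
cancel by their own symmetry, and what remains is `f^*ω = ω`. -/
theorem det_eq_one_of_exact {f : ℝ × ℝ → ℝ × ℝ} (hf : ContDiff ℝ 2 f) {F : ℝ × ℝ → ℝ}
    (hF : ∀ z, HasFDerivAt F (pullback f z - z.2 • ContinuousLinearMap.fst ℝ ℝ ℝ) z)
    (z : ℝ × ℝ) :
    (fderiv ℝ f z (1, 0)).1 * (fderiv ℝ f z (0, 1)).2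
      - (fderiv ℝ f z (0, 1)).1 * (fderiv ℝ f z (1, 0)).2 = 1 := by
  have hf1 : ContDiff ℝ 1 (fderiv ℝ f) := hf.fderiv_right (by norm_num)
  have df : HasFDerivAt f (fderiv ℝ f z) z := ((hf.differentiable two_ne_zero) z).hasFDerivAt
  have d2 : HasFDerivAt (fderiv ℝ f) (fderiv ℝ (fderiv ℝ f) z) z :=
    ((hf1.differentiable one_ne_zero) z).hasFDerivAt
  set W : ℝ × ℝ → (ℝ × ℝ →L[ℝ] ℝ) := fun z => pullback f z - z.2 • ContinuousLinearMap.fst ℝ ℝ ℝ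
  have hW : ContDiff ℝ 1 W := by
    have h1 : ContDiff ℝ 1 (pullback f) :=
      (contDiff_snd.comp (hf.of_le (by norm_num))).smul (contDiff_const.clm_comp hf1)
    exact h1.sub (contDiff_snd.smul contDiff_const)
  have dW : HasFDerivAt W (fderiv ℝ W z) z := ((hW.differentiable one_ne_zero) z).hasFDerivAt
  have key : ∀ v w : ℝ × ℝ, fderiv ℝ W z v w = (f z).2 * (fderiv ℝ (fderiv ℝ f) z v w).1
      + (fderiv ℝ f z v).2 * (fderiv ℝ f z w).1 - v.2 * w.1 := by
    intro v w
    have h1 := dW.clm_apply (hasFDerivAt_const w z)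
    have h3 : HasFDerivAt (fun y => (fderiv ℝ f y w).1) _ z :=
      hasFDerivAt_fst.comp z (d2.clm_apply (hasFDerivAt_const w z))
    have h4 : HasFDerivAt (fun y => (f y).2) _ z := hasFDerivAt_snd.comp z df
    have h2 := (h4.mul h3).sub ((hasFDerivAt_snd (𝕜 := ℝ) (p := z)).mul_const w.1)
    have h5 := congrArg (fun l => l v) (h1.unique h2)
    simpa [mul_comm] using h5
  have hs := second_derivative_symmetric hF dW (1, 0) (0, 1)
  rw [key, key] at hs
  have := second_derivative_symmetric
    (fun y => ((hf.differentiable two_ne_zero) y).hasFDerivAt) d2 (1, 0) (0, 1)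
  rw [this] at hs
  simp at hs
  linarith

/-- A linear endomorphism of the plane with determinant one, as an equivalence. -/
noncomputable def planeEquiv (D : ℝ × ℝ →L[ℝ] ℝ × ℝ)
    (h : (D (1, 0)).1 * (D (0, 1)).2 - (D (0, 1)).1 * (D (1, 0)).2 = 1) :
    (ℝ × ℝ) ≃L[ℝ] ℝ × ℝ :=
  LinearEquiv.toContinuousLinearEquiv <| LinearEquiv.ofInjectiveEndo (D : ℝ × ℝ →ₗ[ℝ] ℝ × ℝ) <| by
    refine (injective_iff_map_eq_zero _).2 fun z hz => ?_
    have hz' : z.1 • D (1, 0) + z.2 • D (0, 1) = 0 := by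
      rw [← map_smul, ← map_smul, ← map_add]; simpa using hz
    have h1 := congrArg Prod.fst hz'
    have h2 := congrArg Prod.snd hz'
    simp only [Prod.fst_add, Prod.smul_fst, smul_eq_mul, Prod.fst_zero, Prod.snd_add,
      Prod.smul_snd, Prod.snd_zero] at h1 h2
    ext
    · simp only [Prod.fst_zero]
      linear_combination (D (0, 1)).2 * h1 - (D (0, 1)).1 * h2 - z.1 * h
    · simp only [Prod.snd_zero]
      linear_combination (D (1, 0)).1 * h2 - (D (1, 0)).2 * h1 - z.2 * h

theorem coe_planeEquiv (D : ℝ × ℝ →L[ℝ] ℝ × ℝ)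
    (h : (D (1, 0)).1 * (D (0, 1)).2 - (D (0, 1)).1 * (D (1, 0)).2 = 1) :
    (planeEquiv D h : ℝ × ℝ →L[ℝ] ℝ × ℝ) = D := by
  refine ContinuousLinearMap.ext fun z => ?_
  rfl

theorem equivariant_zsmul {T : ℝ} {f : ℝ × ℝ → ℝ × ℝ} (hf : ∀ z, f (z + (T, 0)) = f z + (T, 0))
    (m : ℤ) (z : ℝ × ℝ) : f (z + (m * T, 0)) = f z + (m * T, 0) := by
  induction m using Int.induction_on with
  | zero => simp [Prod.mk_zero_zero]
  | succ n ih =>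
    have h1 : z + (((n + 1 : ℤ) : ℝ) * T, (0 : ℝ)) = (z + (((n : ℤ) : ℝ) * T, 0)) + (T, 0) := by
      ext <;> simp <;> ring
    rw [h1, hf, ih]; ext <;> simp <;> ring
  | pred n ih =>
    have h1 : (z + (((-n - 1 : ℤ) : ℝ) * T, (0 : ℝ))) + (T, 0) = z + (((-n : ℤ) : ℝ) * T, 0) := by
      ext <;> simp <;> ring
    have h2 := hf (z + (((-n - 1 : ℤ) : ℝ) * T, (0 : ℝ)))
    rw [h1, ih] at h2
    have h3 : f (z + (((-n - 1 : ℤ) : ℝ) * T, (0 : ℝ)))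
      = f z + (((-n : ℤ) : ℝ) * T, 0) - (T, 0) := by rw [h2]; simp
    rw [h3]; ext <;> simp <;> ring

/-- The displacement `f - id` is periodic in `q` and vanishes for `c < |p|`, so a bound on one
compact rectangle suffices. -/
theorem exists_norm_sub_le {T : ℝ} (hT : 0 < T) {f : ℝ × ℝ → ℝ × ℝ} (hc : Continuous f)
    (hf : ∀ z, f (z + (T, 0)) = f z + (T, 0)) {c : ℝ} (hid : ∀ z : ℝ × ℝ, c < |z.2| → f z = z) :
    ∃ M, ∀ z, ‖f z - z‖ ≤ M := by
  obtain ⟨M, hM⟩ := ((isCompact_Icc (a := (0 : ℝ)) (b := T)).prod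
    (isCompact_Icc (a := -c) (b := c))).exists_bound_of_continuousOn
    (f := fun z => f z - z) (by fun_prop)
  refine ⟨max M 0, fun z => ?_⟩
  by_cases hz : c < |z.2|
  · simp [hid z hz]
  · obtain ⟨m, hm, -⟩ := existsUnique_add_zsmul_mem_Ico hT z.1 0
    have h1 := hM (z + (m * T, 0)) ⟨?_, ?_⟩
    · rw [equivariant_zsmul hf] at h1
      simp only [add_sub_add_right_eq_sub] at h1
      exact h1.trans (le_max_left _ _)
    · simp only [zsmul_eq_mul, zero_add] at hm
      exact Ico_subset_Icc_self hm
    · simpa [abs_le] using not_lt.1 hz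

/-- The range is open by the inverse function theorem, and closed because bounded displacement
confines the preimages of points near `y` to a ball about `y`. The plane is connected. -/
theorem surjective_of_local_diffeo {f : ℝ × ℝ → ℝ × ℝ} (hf : ContDiff ℝ 1 f)
    (hdet : ∀ z, (fderiv ℝ f z (1, 0)).1 * (fderiv ℝ f z (0, 1)).2
      - (fderiv ℝ f z (0, 1)).1 * (fderiv ℝ f z (1, 0)).2 = 1)
    {M : ℝ} (hM : ∀ z, ‖f z - z‖ ≤ M) : IsOpenMap f ∧ Function.Surjective f := by
  have ho : IsOpenMap f := by
    refine isOpenMap_iff_nhds_le.2 fun z => ?_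
    have h1 : HasStrictFDerivAt f (planeEquiv _ (hdet z) : ℝ × ℝ →L[ℝ] ℝ × ℝ) z := by
      rw [coe_planeEquiv]; exact hf.contDiffAt.hasStrictFDerivAt one_ne_zero
    exact (h1.map_nhds_eq_of_equiv).ge
  refine ⟨ho, ?_⟩
  have hcl : IsClosed (range f) := by
    refine isClosed_of_closure_subset fun y hy => ?_
    have hK : IsCompact (f '' Metric.closedBall y (M + 1)) :=
      (isCompact_closedBall _ _).image hf.continuous
    have : y ∈ closure (f '' Metric.closedBall y (M + 1)) := by
      rw [Metric.mem_closure_iff] at hy ⊢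
      intro ε hε
      obtain ⟨_, ⟨z, rfl⟩, hz⟩ := hy (min ε 1) (by positivity)
      refine ⟨f z, ⟨z, ?_, rfl⟩, hz.trans_le (min_le_left _ _)⟩
      have h1 : dist z y ≤ dist z (f z) + dist (f z) y := dist_triangle _ _ _
      have h2 : dist z (f z) ≤ M := by rw [dist_comm, dist_eq_norm]; exact hM z
      have h3 : dist (f z) y < 1 := by rw [dist_comm]; exact hz.trans_le (min_le_right _ _)
      rw [Metric.mem_closedBall]; linarith
    rw [hK.isClosed.closure_eq] at this
    exact image_subset_range _ _ this
  exact range_eq_univ.1 (IsClopen.eq_univ ⟨hcl, ho.isOpen_range⟩ ⟨f 0, mem_range_self _⟩)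

theorem proj_add_period (T : ℝ) (m : ℤ) (z : ℝ × ℝ) : proj T (z + (m * T, 0)) = proj T z := by
  ext <;> simp [proj]

theorem proj_eq_iff {T : ℝ} {z z' : ℝ × ℝ} :
    proj T z = proj T z' ↔ ∃ m : ℤ, z' = z + (m * T, 0) := by
  constructor
  · intro h
    have h1 := congrArg Prod.fst h
    have h2 := congrArg Prod.snd h
    simp only [proj] at h1 h2
    rw [eq_comm, ← sub_eq_zero, ← QuotientAddGroup.mk_sub, AddCircle.coe_eq_zero_iff] at h1
    obtain ⟨m, hm⟩ := h1
    refine ⟨m, ?_⟩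
    ext
    · simp only [zsmul_eq_mul] at hm
      simp [hm]
    · simp [h2]
  · rintro ⟨m, rfl⟩
    exact (proj_add_period T m z).symm

/-- Uniqueness of trajectories gives most properties of the time-one map: a translate by `T` of a
trajectory is a trajectory, points near the ends have constant trajectories, and trajectories that
meet at time one agree at time zero. Surjectivity comes from area preservation and bounded
displacement. -/
theorem IsHamDiffeo.exists_exactLift {T : ℝ} (hT : 0 < T) {φ : Cyl T → Cyl T}
    (hφ : IsHamDiffeo φ) : ∃ Λ : ExactLift T, ∀ z, φ (proj T z) = proj T (Λ.toFun z) := by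
  obtain ⟨H, Φ, hH, ⟨c₀, hc₀1, hc₀⟩, hΦ, hΦ0, hflow, hφ⟩ := hφ
  set c := max c₀ 0
  have hc1 : c < 1 := max_lt hc₀1 one_pos
  have hc : ∀ t (x : Cyl T), c < |x.2| → H t x = 0 := fun t x hx =>
    hc₀ t x ((le_max_left _ _).trans_lt hx)
  set K : ℝ × (ℝ × ℝ) → ℝ := fun x => H x.1 (proj T x.2) with hKd
  set V : ℝ × (ℝ × ℝ) → ℝ × ℝ := fun x => hamField (fun y => K (x.1, y)) x.2 with hVd
  have hKs : ∀ t z, fderiv ℝ (fun y => K (t, y)) z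
      = (fderiv ℝ K (t, z)).comp (ContinuousLinearMap.inr ℝ ℝ (ℝ × ℝ)) := fun t z =>
    (((hH.differentiable (by simp)) (t, z)).hasFDerivAt.comp z
      (hasFDerivAt_prodMk_right t z)).fderiv
  have hV : ContDiff ℝ 1 V := by
    have h1 : ContDiff ℝ 1 (fderiv ℝ K) := hH.fderiv_right (by norm_cast)
    have h2 : V = fun x => (-(fderiv ℝ K x (0, (0, 1))), fderiv ℝ K x (0, (1, 0))) := by
      ext x <;> simp [hVd, hamField, hKs]
    rw [h2]
    exact (h1.clm_apply contDiff_const).neg.prodMk (h1.clm_apply contDiff_const)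
  have hflow' : ∀ z t, HasDerivAt (fun τ => Φ τ z) (V (t, Φ t z)) t := fun z t => hflow t z
  have hVT : ∀ t z, V (t, z + (T, 0)) = V (t, z) := by
    intro t z
    have h1 : (fun y => K (t, y + (T, 0))) = fun y => K (t, y) := by
      ext y
      have := proj_add_period T 1 y
      simp only [Int.cast_one, one_mul] at this
      simp [hKd, this]
    have h2 : fderiv ℝ (fun y => K (t, y)) (z + (T, 0)) = fderiv ℝ (fun y => K (t, y)) z := by
      rw [← fderiv_comp_add_right, h1]
    simp [hVd, hamField, h2]
  have hV0 : ∀ t (z : ℝ × ℝ), c < |z.2| → V (t, z) = 0 := by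
    intro t z hz
    have h1 : (fun y => K (t, y)) =ᶠ[𝓝 z] fun _ => (0 : ℝ) := by
      have : ∀ᶠ y : ℝ × ℝ in 𝓝 z, c < |y.2| :=
        (isOpen_lt continuous_const (by fun_prop : Continuous fun y : ℝ × ℝ => |y.2|)).mem_nhds hz
      filter_upwards [this] with y hy
      exact hc t _ hy
    simp [hVd, hamField, h1.fderiv_eq]
  have hequi : ∀ z, Φ 1 (z + (T, 0)) = Φ 1 z + (T, 0) := by
    intro z
    have := eq_of_hasDerivAt_of_contDiff hV (α := fun t => Φ t (z + (T, 0)))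
      (β := fun t => Φ t z + (T, 0)) (t₀ := 0) (hflow' _)
      (fun t => by rw [hVT]; exact (hflow' z t).add_const _) (by simp [hΦ0])
    exact congrFun this 1
  have hid : ∀ z : ℝ × ℝ, c < |z.2| → Φ 1 z = z := by
    intro z hz
    have := eq_of_hasDerivAt_of_contDiff hV (α := fun t => Φ t z)
      (β := fun t => z) (t₀ := 0) (hflow' _)
      (fun t => by rw [hV0 t z hz]; exact hasDerivAt_const _ _) (by simp [hΦ0])
    exact congrFun this 1
  have hinj : Function.Injective (Φ 1) := by
    intro z z' h
    have := eq_of_hasDerivAt_of_contDiff hV (α := fun t => Φ t z)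
      (β := fun t => Φ t z') (t₀ := 1) (hflow' _) (hflow' _) h
    simpa [hΦ0] using congrFun this 0
  have hsm : ContDiff ℝ ∞ (Φ 1) := hΦ.comp (contDiff_const.prodMk contDiff_id)
  obtain ⟨F, hF⟩ := exists_prim_of_flow (K := K) (B := fun x => Φ x.1 x.2)
    (hH.of_le (by norm_cast)) (hΦ.of_le (by norm_cast)) hΦ0 hflow
  have hdet := det_eq_one_of_exact (hsm.of_le (by norm_cast)) hF
  obtain ⟨M, hM⟩ := exists_norm_sub_le hT hsm.continuous hequi hid
  obtain ⟨hopen, hsurj⟩ := surjective_of_local_diffeo (hsm.of_le (by norm_cast)) hdet hM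
  let e : (ℝ × ℝ) ≃ₜ ℝ × ℝ :=
    (Equiv.ofBijective (Φ 1) ⟨hinj, hsurj⟩).toHomeomorphOfContinuousOpen hsm.continuous hopen
  have he : ContDiff ℝ ∞ e.symm := by
    refine e.contDiff_symm (f₀' := fun z => planeEquiv _ (hdet z)) (fun z => ?_) hsm
    rw [coe_planeEquiv]
    exact ((hsm.differentiable (by simp)) z).hasFDerivAt
  exact ⟨⟨Φ 1, e.symm, F, hsm, he, e.symm_apply_apply, e.apply_symm_apply, hequi, hF,
    c, le_max_right _ _, hc1, hid⟩, hφ⟩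

/-! ### The group of exact lifts and curves straightened by them. -/

namespace ExactLift

variable {T : ℝ}

theorem hasFDerivAt (Λ : ExactLift T) (z : ℝ × ℝ) :
    HasFDerivAt Λ.toFun (fderiv ℝ Λ.toFun z) z :=
  ((Λ.contDiff_toFun.differentiable (by simp)) z).hasFDerivAt

theorem det_eq_one (Λ : ExactLift T) (z : ℝ × ℝ) :
    (fderiv ℝ Λ.toFun z (1, 0)).1 * (fderiv ℝ Λ.toFun z (0, 1)).2
      - (fderiv ℝ Λ.toFun z (0, 1)).1 * (fderiv ℝ Λ.toFun z (1, 0)).2 = 1 :=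
  det_eq_one_of_exact (Λ.contDiff_toFun.of_le (by norm_cast)) Λ.hasFDerivAt_prim z

/-- The inverse of an exact lift. -/
noncomputable def symm (Λ : ExactLift T) : ExactLift T where
  toFun := Λ.invFun
  invFun := Λ.toFun
  prim := fun z => -Λ.prim (Λ.invFun z)
  contDiff_toFun := Λ.contDiff_invFun
  contDiff_invFun := Λ.contDiff_toFun
  left_inv := Λ.right_inv
  right_inv := Λ.left_inv
  equivariant z := by
    have := Λ.equivariant (Λ.invFun z)
    rw [Λ.right_inv] at this
    rw [← this, Λ.left_inv]
  hasFDerivAt_prim z := by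
    have hg : HasFDerivAt Λ.invFun (fderiv ℝ Λ.invFun z) z :=
      ((Λ.contDiff_invFun.differentiable (by simp)) z).hasFDerivAt
    have h1 := ((Λ.hasFDerivAt_prim (Λ.invFun z)).comp z hg).neg
    refine h1.congr_fderiv ?_
    have h2 : (fderiv ℝ Λ.toFun (Λ.invFun z)).comp (fderiv ℝ Λ.invFun z)
        = ContinuousLinearMap.id ℝ (ℝ × ℝ) := by
      have h3 := (Λ.hasFDerivAt (Λ.invFun z)).comp z hg
      have h4 : Λ.toFun ∘ Λ.invFun = id := funext Λ.right_inv
      rw [h4] at h3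
      exact h3.unique (hasFDerivAt_id z)
    refine ContinuousLinearMap.ext fun e => ?_
    have h5 := congrArg (fun l => (l e).1) h2
    simp only [ContinuousLinearMap.comp_apply, ContinuousLinearMap.id_apply] at h5
    simp [pullback, Λ.right_inv, h5]
  eq_self := by
    obtain ⟨c, h0, h1, h⟩ := Λ.eq_self
    refine ⟨c, h0, h1, fun z hz => ?_⟩
    conv_lhs => rw [← h z hz]
    exact Λ.left_inv z

/-- The composition `Λ ∘ Ξ` of exact lifts. -/
noncomputable def comp (Λ Ξ : ExactLift T) : ExactLift T where
  toFun := Λ.toFun ∘ Ξ.toFun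
  invFun := Ξ.invFun ∘ Λ.invFun
  prim := fun z => Λ.prim (Ξ.toFun z) + Ξ.prim z
  contDiff_toFun := Λ.contDiff_toFun.comp Ξ.contDiff_toFun
  contDiff_invFun := Ξ.contDiff_invFun.comp Λ.contDiff_invFun
  left_inv z := by simp [Λ.left_inv, Ξ.left_inv]
  right_inv z := by simp [Λ.right_inv, Ξ.right_inv]
  equivariant z := by simp [Λ.equivariant, Ξ.equivariant]
  hasFDerivAt_prim z := by
    have h1 := ((Λ.hasFDerivAt_prim (Ξ.toFun z)).comp z (Ξ.hasFDerivAt z)).add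
      (Ξ.hasFDerivAt_prim z)
    refine h1.congr_fderiv ?_
    refine ContinuousLinearMap.ext fun e => ?_
    have h2 := ((Λ.hasFDerivAt (Ξ.toFun z)).comp z (Ξ.hasFDerivAt z)).fderiv
    simp [pullback, h2]
  eq_self := by
    obtain ⟨c, h0, h1, h⟩ := Λ.eq_self
    obtain ⟨d, h2, h3, h'⟩ := Ξ.eq_self
    refine ⟨max c d, h0.trans (le_max_left _ _), max_lt h1 h3, fun z hz => ?_⟩
    rw [Function.comp_apply, h' z ((le_max_right _ _).trans_lt hz),
      h z ((le_max_left _ _).trans_lt hz)]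

/-- The coefficient of the pullback of `λ` along the zero section. -/
noncomputable def dens (Ψ : ExactLift T) (q : ℝ) : ℝ :=
  (Ψ.toFun (q, 0)).2 * (fderiv ℝ Ψ.toFun (q, 0) (1, 0)).1

/-- `Ψ` maps `L` to the zero section. -/
def Straightens (Ψ : ExactLift T) (L : Set (Cyl T)) : Prop :=
  ∀ z, proj T z ∈ L ↔ (Ψ.toFun z).2 = 0

theorem continuous_toFun (Ψ : ExactLift T) : Continuous Ψ.toFun := Ψ.contDiff_toFun.continuous

theorem continuous_fderiv (Ψ : ExactLift T) : Continuous (fderiv ℝ Ψ.toFun) :=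
  Ψ.contDiff_toFun.continuous_fderiv (by simp)

theorem continuous_dens (Ψ : ExactLift T) : Continuous Ψ.dens := by
  have h1 := Ψ.continuous_toFun
  have h2 := Ψ.continuous_fderiv
  unfold dens
  fun_prop

theorem hasDerivAt_line (q p : ℝ) : HasDerivAt (fun q : ℝ => (q, p)) ((1 : ℝ), (0 : ℝ)) q :=
  (hasDerivAt_id q).prodMk (hasDerivAt_const q p)

theorem hasDerivAt_prim (Ψ : ExactLift T) (q : ℝ) :
    HasDerivAt (fun q => Ψ.prim (q, 0)) (Ψ.dens q) q := by
  have := (Ψ.hasFDerivAt_prim (q, 0)).comp_hasDerivAt q (hasDerivAt_line q 0)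
  simpa [pullback, dens, Function.comp_def] using this

theorem proj_surjective : Function.Surjective (proj T) := by
  rintro ⟨x, p⟩
  obtain ⟨q, rfl⟩ := QuotientAddGroup.mk_surjective x
  exact ⟨(q, p), rfl⟩

theorem invFun_add (Λ : ExactLift T) (m : ℤ) (z : ℝ × ℝ) :
    Λ.invFun (z + (m * T, 0)) = Λ.invFun z + (m * T, 0) :=
  equivariant_zsmul Λ.symm.equivariant m z

theorem toFun_add (Λ : ExactLift T) (m : ℤ) (z : ℝ × ℝ) :
    Λ.toFun (z + (m * T, 0)) = Λ.toFun z + (m * T, 0) :=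
  equivariant_zsmul Λ.equivariant m z

theorem mem_image_iff {φ : Cyl T → Cyl T} {Λ : ExactLift T}
    (h : ∀ z, φ (proj T z) = proj T (Λ.toFun z)) {A : Set (Cyl T)} (z : ℝ × ℝ) :
    proj T z ∈ φ '' A ↔ proj T (Λ.invFun z) ∈ A := by
  constructor
  · rintro ⟨x, hx, hz⟩
    obtain ⟨y, rfl⟩ := proj_surjective x
    rw [h, proj_eq_iff] at hz
    obtain ⟨m, rfl⟩ := hz
    rwa [invFun_add, Λ.left_inv, proj_add_period]
  · intro hz
    exact ⟨_, hz, by rw [h, Λ.right_inv]⟩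

end ExactLift

open ExactLift

/-! ### Actions as values of the primitive; transversality. -/

theorem IsHamIsotopic.exists_straightens {T : ℝ} (hT : 0 < T) {L : Set (Cyl T)}
    (hL : IsHamIsotopic L) : ∃ Ψ : ExactLift T, Ψ.Straightens L := by
  obtain ⟨ψ, hψ, rfl⟩ := hL
  obtain ⟨Λ, hΛ⟩ := hψ.exists_exactLift hT
  exact ⟨Λ.symm, fun z => mem_image_iff hΛ z⟩

theorem ExactLift.Straightens.image {T : ℝ} {Ψ Λ : ExactLift T} {L : Set (Cyl T)}
    (h : Ψ.Straightens L) {φ : Cyl T → Cyl T} (hΛ : ∀ z, φ (proj T z) = proj T (Λ.toFun z)) :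
    (Ψ.comp Λ.symm).Straightens (φ '' L) := fun z =>
  (mem_image_iff hΛ z).trans (h _)

theorem pt_mem_zeroSection {T : ℝ} (q : ℝ) : pt T q ∈ zeroSection T := rfl

theorem ExactLift.Straightens.pt_mem {T : ℝ} {Ψ : ExactLift T} {L : Set (Cyl T)}
    (h : Ψ.Straightens L) (q : ℝ) : pt T q ∈ L ↔ (Ψ.toFun (q, 0)).2 = 0 := h (q, 0)

/-- The form `Ψ^*λ` vanishes on `L`, since `Ψ` takes `L` to `p = 0`; so `λ = -d prim` along `L`. The
proof parametrizes `L` by the line through `Ψ.invFun`, whose connectedness yields a single constant.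
-/
theorem IsMarking.exists_eq {T : ℝ} {Ψ : ExactLift T} {L : Set (Cyl T)}
    (hΨ : Ψ.Straightens L) {h : Cyl T → ℝ} (hh : IsMarking L h) :
    ∃ C, ∀ q, pt T q ∈ L → h (pt T q) = -Ψ.prim (q, 0) + C := by
  set γ : ℝ → ℝ × ℝ := fun t => Ψ.invFun (t, 0)
  have hγ : IsSmoothPathIn L γ :=
    ⟨Ψ.contDiff_invFun.comp (contDiff_id.prodMk contDiff_const),
      fun t => (hΨ _).2 (by simp [γ, Ψ.right_inv])⟩
  have hd : ∀ t, HasDerivAt (fun t => h (proj T (γ t)) - Ψ.symm.prim (t, 0)) 0 t := by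
    intro t
    have h1 := (hh γ hγ t).sub (Ψ.symm.hasDerivAt_prim t)
    refine h1.congr_deriv ?_
    have h2 : HasDerivAt γ (fderiv ℝ Ψ.symm.toFun (t, 0) (1, 0)) t :=
      (Ψ.symm.hasFDerivAt (t, 0)).comp_hasDerivAt t (hasDerivAt_line t 0)
    rw [h2.deriv, dens]
    exact sub_self _
  have hc := is_const_of_deriv_eq_zero (fun t => (hd t).differentiableAt) (fun t => (hd t).deriv)
  refine ⟨h (proj T (γ 0)) - Ψ.symm.prim (0, 0), fun q hq => ?_⟩
  have h1 := hc (Ψ.toFun (q, 0)).1 0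
  have h2 : ((Ψ.toFun (q, 0)).1, (0 : ℝ)) = Ψ.toFun (q, 0) := by
    ext
    · rfl
    · exact ((hΨ.pt_mem q).1 hq).symm
  have h3 : Ψ.symm.prim (Ψ.toFun (q, 0)) = -Ψ.prim (q, 0) := by
    simp [ExactLift.symm, Ψ.left_inv]
  simp only [γ, h2, h3, Ψ.left_inv] at h1
  have h4 : pt T q = proj T (q, 0) := rfl
  rw [h4]
  linarith

theorem exists_action_eq {T : ℝ} {Ψ : ExactLift T} {L : Set (Cyl T)}
    (hΨ : Ψ.Straightens L) {h₀ h : Cyl T → ℝ} (hh₀ : IsMarking (zeroSection T) h₀)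
    (hh : IsMarking L h) :
    ∃ C, ∀ q, pt T q ∈ L → action h₀ h (pt T q) = Ψ.prim (q, 0) + C := by
  obtain ⟨C, hC⟩ := hh.exists_eq hΨ
  have hd : ∀ t, HasDerivAt (fun t => h₀ (pt T t)) 0 t := by
    intro t
    have := hh₀ (fun t => (t, 0)) ⟨contDiff_id.prodMk contDiff_const, fun t => rfl⟩ t
    simpa [pt] using this
  have hc := is_const_of_deriv_eq_zero (fun t => (hd t).differentiableAt) (fun t => (hd t).deriv)
  refine ⟨h₀ (pt T 0) - C, fun q hq => ?_⟩
  rw [action, hC q hq, hc q 0]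
  ring

/-- If `ρ = (Ψ.toFun ·).2` were critical along the zero section, `dρ` would kill the tangent vectors
of both curves. By transversality `dρ` would then vanish, against the determinant being one. -/
theorem Transverse.deriv_ne_zero {T : ℝ} {Ψ : ExactLift T} {L : Set (Cyl T)}
    (hΨ : Ψ.Straightens L) (ht : Transverse (zeroSection T) L) {q : ℝ} (hq : pt T q ∈ L) :
    (fderiv ℝ Ψ.toFun (q, 0) (1, 0)).2 ≠ 0 := by
  intro h0
  have hspan := ht (q, 0) ⟨rfl, hq⟩
  set ℓ : ℝ × ℝ →ₗ[ℝ] ℝ :=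
    (LinearMap.snd ℝ ℝ ℝ).comp (fderiv ℝ Ψ.toFun (q, 0) : ℝ × ℝ →ₗ[ℝ] ℝ × ℝ) with hℓ
  have hle : Submodule.span ℝ (tangentVectors (zeroSection T) (q, 0) ∪ tangentVectors L (q, 0))
      ≤ LinearMap.ker ℓ := by
    rw [Submodule.span_le]
    rintro u (⟨γ, ⟨hγ, hγL⟩, hγ0, rfl⟩ | ⟨γ, ⟨hγ, hγL⟩, hγ0, rfl⟩)
    · have h1 : HasDerivAt γ (deriv γ 0) 0 := (hγ.differentiable (by simp) 0).hasDerivAt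
      have h2 : HasDerivAt (fun t => (γ t).2) (deriv γ 0).2 0 :=
        (hasFDerivAt_snd (p := γ 0)).comp_hasDerivAt (0 : ℝ) h1
      have h3 : (fun t => (γ t).2) = fun _ => 0 := funext fun t => hγL t
      rw [h3] at h2
      have h4 := h2.unique (hasDerivAt_const _ _)
      have h5 : deriv γ 0 = (deriv γ 0).1 • ((1 : ℝ), (0 : ℝ)) := by ext <;> simp [h4]
      rw [SetLike.mem_coe, LinearMap.mem_ker, h5, map_smul]
      simp [hℓ, h0]
    · have h1 : HasDerivAt γ (deriv γ 0) 0 := (hγ.differentiable (by simp) 0).hasDerivAt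
      have h2 : HasDerivAt (fun t => (Ψ.toFun (γ t)).2) (ℓ (deriv γ 0)) 0 := by
        have h3 := Ψ.hasFDerivAt (γ 0)
        have h4 := (hasFDerivAt_snd (p := Ψ.toFun (γ 0))).comp_hasDerivAt (0 : ℝ)
          (h3.comp_hasDerivAt (0 : ℝ) h1)
        rw [hγ0] at h4
        exact h4
      have h3 : (fun t => (Ψ.toFun (γ t)).2) = fun _ => 0 := funext fun t => (hΨ _).1 (hγL t)
      rw [h3] at h2
      exact h2.unique (hasDerivAt_const _ _)
  rw [hspan, top_le_iff, LinearMap.ker_eq_top] at hle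
  have h1 : (fderiv ℝ Ψ.toFun (q, 0) (0, 1)).2 = 0 := by
    have := congrArg (fun l => l (0, 1)) hle
    simpa [hℓ] using this
  have := Ψ.det_eq_one (q, 0)
  rw [h0, h1] at this
  simp at this

/-- At a transverse intersection point the two adjacent segments of the zero section lie on
different sides of `L`. -/
theorem Transverse.not_same_sign {T : ℝ} {Ψ : ExactLift T} {L : Set (Cyl T)}
    (hΨ : Ψ.Straightens L) (ht : Transverse (zeroSection T) L) {q a b : ℝ} (hq : pt T q ∈ L)
    (ha : a < q) (hb : q < b) (e : ℝ) (he : e ≠ 0)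
    (h1 : ∀ x ∈ Ioo a q, 0 < e * (Ψ.toFun (x, 0)).2)
    (h2 : ∀ x ∈ Ioo q b, 0 < e * (Ψ.toFun (x, 0)).2) : False := by
  have hd : HasDerivAt (fun x => (Ψ.toFun (x, 0)).2) (fderiv ℝ Ψ.toFun (q, 0) (1, 0)).2 q := by
    have h3 := (Ψ.hasFDerivAt (q, 0)).comp_hasDerivAt q (hasDerivAt_line q 0)
    exact (hasFDerivAt_snd (p := Ψ.toFun (q, 0))).comp_hasDerivAt q h3
  have h0 : (Ψ.toFun (q, 0)).2 = 0 := (hΨ.pt_mem q).1 hq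
  have hmin : IsLocalMin (fun x => e * (Ψ.toFun (x, 0)).2) q := by
    filter_upwards [Ioo_mem_nhds ha hb] with x hx
    rw [h0, mul_zero]
    rcases lt_trichotomy x q with h | rfl | h
    · exact (h1 x ⟨hx.1, h⟩).le
    · rw [h0, mul_zero]
    · exact (h2 x ⟨h, hx.2⟩).le
  have := hmin.hasDerivAt_eq_zero (hd.const_mul e)
  exact (ht.deriv_ne_zero hΨ hq) ((mul_eq_zero.1 this).resolve_left he)

/-! ### Regions as connected components. -/

theorem continuous_proj (T : ℝ) : Continuous (proj T) :=
  ((AddCircle.continuous_mk' T).comp continuous_fst).prodMk continuous_snd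

theorem isOpenMap_proj (T : ℝ) : IsOpenMap (proj T) :=
  (QuotientAddGroup.isOpenMap_coe (N := AddSubgroup.zmultiples T)).prodMap IsOpenMap.id

theorem isQuotientMap_proj (T : ℝ) : IsQuotientMap (proj T) :=
  (isOpenMap_proj T).isQuotientMap (continuous_proj T) proj_surjective

instance locallyConnectedSpace_cyl (T : ℝ) : LocallyConnectedSpace (Cyl T) :=
  (isQuotientMap_proj T).isCoinducing.locallyConnectedSpace

/-- The complement of the two curves, whose components are the regions. -/
def free {T : ℝ} (L : Set (Cyl T)) : Set (Cyl T) := annulus T \ (zeroSection T ∪ L)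

theorem ExactLift.Straightens.isClosed {T : ℝ} {Ψ : ExactLift T} {L : Set (Cyl T)}
    (hΨ : Ψ.Straightens L) : IsClosed L := by
  rw [← (isQuotientMap_proj T).isClosed_preimage]
  have : proj T ⁻¹' L = (fun z => (Ψ.toFun z).2) ⁻¹' {0} := by ext z; exact hΨ z
  rw [this]
  exact isClosed_singleton.preimage (continuous_snd.comp Ψ.continuous_toFun)

theorem isOpen_free {T : ℝ} {L : Set (Cyl T)} (hL : IsClosed L) : IsOpen (free L) := by
  have h1 : IsOpen (annulus T) :=
    isOpen_lt (by fun_prop : Continuous fun x : Cyl T => |x.2|) continuous_const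
  have h2 : IsClosed (zeroSection T) := isClosed_eq continuous_snd continuous_const
  exact h1.sdiff (h2.union hL)

section regions

variable {T : ℝ} {L R R₁ R₂ : Set (Cyl T)}

theorem isOpen_of_mem_regions (hL : IsClosed L) (hR : R ∈ regions L) : IsOpen R := by
  obtain ⟨x, hx, rfl⟩ := hR
  exact (isOpen_free hL).connectedComponentIn

theorem subset_free_of_mem_regions (hR : R ∈ regions L) : R ⊆ free L := by
  obtain ⟨x, hx, rfl⟩ := hR
  exact connectedComponentIn_subset _ _

theorem isPreconnected_of_mem_regions (hR : R ∈ regions L) : IsPreconnected R := by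
  obtain ⟨x, hx, rfl⟩ := hR
  exact isPreconnected_connectedComponentIn

theorem nonempty_of_mem_regions (hR : R ∈ regions L) : R.Nonempty := by
  obtain ⟨x, hx, rfl⟩ := hR
  exact ⟨x, mem_connectedComponentIn hx⟩

theorem regions_subset_of_nonempty (hR : R ∈ regions L) {A : Set (Cyl T)} (hA : IsPreconnected A)
    (hAL : A ⊆ free L) (h : (A ∩ R).Nonempty) : A ⊆ R := by
  obtain ⟨x, hx, rfl⟩ := hR
  obtain ⟨y, hyA, hy⟩ := h
  rw [connectedComponentIn_eq hy]
  exact hA.subset_connectedComponentIn hyA hAL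

theorem regions_eq_of_nonempty (h₁ : R₁ ∈ regions L) (h₂ : R₂ ∈ regions L)
    (h : (R₁ ∩ R₂).Nonempty) : R₁ = R₂ :=
  (regions_subset_of_nonempty h₂ (isPreconnected_of_mem_regions h₁)
    (subset_free_of_mem_regions h₁) h).antisymm
    (regions_subset_of_nonempty h₁ (isPreconnected_of_mem_regions h₂)
      (subset_free_of_mem_regions h₂) (inter_comm R₁ R₂ ▸ h))

theorem exists_mem_regions {x : Cyl T} (hx : x ∈ free L) : ∃ R ∈ regions L, x ∈ R :=
  ⟨_, ⟨x, hx, rfl⟩, mem_connectedComponentIn hx⟩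

end regions

/-! ### The two sides of the zero section. -/

namespace Side

/-- The lower end of the range of `p` on a side of the zero section. -/
def lo : Side → ℝ
  | above => 0
  | below => -1

/-- The upper end of the range of `p` on a side of the zero section. -/
def hi : Side → ℝ
  | above => 1
  | below => 0

/-- The value of `p` at the end of the annulus on a side of the zero section. -/
def sgn : Side → ℝ
  | above => 1
  | below => -1

/-- The other side of the zero section. -/
def opp : Side → Side
  | above => below
  | below => above

/-- The part of the annulus on a side of the zero section. -/
def strip (T : ℝ) (σ : Side) : Set (Cyl T) := {x | x.2 ∈ Ioo σ.lo σ.hi}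

theorem lo_lt_hi (σ : Side) : σ.lo < σ.hi := by cases σ <;> simp [lo, hi]

theorem zero_mem (σ : Side) : (0 : ℝ) ∈ Icc σ.lo σ.hi := by cases σ <;> simp [lo, hi]

theorem sgn_mem (σ : Side) : σ.sgn ∈ Icc σ.lo σ.hi := by cases σ <;> simp [lo, hi, sgn]

theorem abs_sgn (σ : Side) : |σ.sgn| = 1 := by cases σ <;> simp [sgn]

theorem ne_zero_of_mem {σ : Side} {p : ℝ} (hp : p ∈ Ioo σ.lo σ.hi) : p ≠ 0 ∧ |p| < 1 := by
  cases σ <;> simp only [lo, hi, mem_Ioo] at hp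
  · exact ⟨hp.1.ne', abs_lt.2 ⟨by linarith, hp.2⟩⟩
  · exact ⟨hp.2.ne, abs_lt.2 ⟨hp.1, by linarith⟩⟩

theorem disjoint_strip {T : ℝ} {σ : Side} {x : Cyl T} (h : x ∈ σ.strip T) :
    x ∉ σ.opp.strip T := by
  cases σ <;> simp only [strip, lo, hi, opp, mem_ofPred_eq, mem_Ioo, not_and, not_lt] at h ⊢
  · intro; linarith
  · intro; linarith

theorem sgn_mul_mem {σ : Side} {t : ℝ} (h0 : 0 < t) (h1 : t < 1) :
    σ.sgn * t ∈ Ioo σ.lo σ.hi := by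
  cases σ <;> simp [sgn, lo, hi, h0, h1]

end Side

/-! ### Regions near points off `L`, and roots. -/

section local_structure

variable {T : ℝ} {L : Set (Cyl T)} {Ψ : ExactLift T}

theorem proj_mem_free (hΨ : Ψ.Straightens L) {σ : Side} {z : ℝ × ℝ} (hz : z.2 ∈ Ioo σ.lo σ.hi)
    (h : (Ψ.toFun z).2 ≠ 0) : proj T z ∈ free L := by
  have := Side.ne_zero_of_mem hz
  refine ⟨this.2, ?_⟩
  rintro (h1 | h1)
  · exact this.1 h1
  · exact h ((hΨ z).1 h1)

/-- Near a point `z` off `L`, in the closure of one side of the zero section, a region on that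
side contains all points on that side or none. -/
theorem exists_nhds_dichotomy (hΨ : Ψ.Straightens L) (σ : Side) {z : ℝ × ℝ}
    (h : (Ψ.toFun z).2 ≠ 0) :
    ∃ U ∈ 𝓝 z, (∀ z' ∈ U, (Ψ.toFun z').2 ≠ 0) ∧ ∀ R ∈ regions L, R ⊆ σ.strip T →
      ((∀ z' ∈ U, z'.2 ∈ Ioo σ.lo σ.hi → proj T z' ∈ R) ∧
        (∀ z' ∈ U, z'.2 ∈ Icc σ.lo σ.hi → proj T z' ∈ closure R)) ∨
      (∀ z' ∈ U, proj T z' ∉ closure R) := by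
  have ho : IsOpen {z | (Ψ.toFun z).2 ≠ 0} :=
    isOpen_ne_fun (continuous_snd.comp Ψ.continuous_toFun) continuous_const
  obtain ⟨r, hr, hball⟩ := Metric.isOpen_iff.1 ho z h
  refine ⟨Metric.ball z r, Metric.ball_mem_nhds z hr, fun z' hz' => hball hz', ?_⟩
  intro R hR hRσ
  -- The part of the ball inside the open strip is convex, and it avoids both curves; so a region
  -- contains its image or misses it.
  set B : Set (ℝ × ℝ) := Metric.ball z r ∩ univ ×ˢ Ioo σ.lo σ.hi with hB
  have hBconv : Convex ℝ B := (convex_ball z r).inter (convex_univ.prod (convex_Ioo _ _))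
  have hBfree : proj T '' B ⊆ free L := by
    rintro _ ⟨y, hy, rfl⟩
    exact proj_mem_free hΨ hy.2.2 (hball hy.1)
  by_cases hne : (proj T '' B ∩ R).Nonempty
  · left
    have hsub : proj T '' B ⊆ R := regions_subset_of_nonempty hR
      (hBconv.isPreconnected.image _ (continuous_proj T).continuousOn) hBfree hne
    refine ⟨fun z' hz' hz'' => hsub ⟨z', ⟨hz', trivial, hz''⟩, rfl⟩, fun z' hz' hz'' => ?_⟩
    have h1 : z' ∈ closure B := by
      refine Metric.isOpen_ball.inter_closure ⟨hz', ?_⟩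
      rw [closure_prod_eq, closure_univ, closure_Ioo σ.lo_lt_hi.ne]
      exact ⟨trivial, hz''⟩
    exact closure_mono hsub
      (image_closure_subset_closure_image (continuous_proj T) ⟨z', h1, rfl⟩)
  · right
    intro z' hz' hcl
    have h1 : z' ∈ closure (proj T ⁻¹' R) := by
      rw [← (isOpenMap_proj T).preimage_closure_eq_closure_preimage (continuous_proj T)]
      exact hcl
    obtain ⟨y, hy, hyR⟩ := mem_closure_iff.1 h1 _ Metric.isOpen_ball hz'
    exact hne ⟨_, ⟨y, ⟨hy, trivial, hRσ hyR⟩, rfl⟩, hyR⟩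

theorem exists_mem_strip_of_nhds {σ : Side} {z : ℝ × ℝ} (hz : z.2 ∈ Icc σ.lo σ.hi)
    {U : Set (ℝ × ℝ)} (hU : U ∈ 𝓝 z) : ∃ z' ∈ U, z'.2 ∈ Ioo σ.lo σ.hi := by
  have h1 : z ∈ closure (univ ×ˢ Ioo σ.lo σ.hi : Set (ℝ × ℝ)) := by
    rw [closure_prod_eq, closure_univ, closure_Ioo σ.lo_lt_hi.ne]
    exact ⟨trivial, hz⟩
  obtain ⟨y, hy, hy'⟩ := mem_closure_iff_nhds.1 h1 U hU
  exact ⟨y, hy, hy'.2⟩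

theorem subset_strip_of_mem {R : Set (Cyl T)} (hR : R ∈ regions L) {σ : Side} {x : Cyl T}
    (hx : x ∈ R) (hxσ : x ∈ σ.strip T) : R ⊆ σ.strip T := by
  have hpre := isPreconnected_of_mem_regions hR
  have hfree := subset_free_of_mem_regions hR
  have ho1 : IsOpen {x : Cyl T | 0 < x.2} := isOpen_lt continuous_const continuous_snd
  have ho2 : IsOpen {x : Cyl T | x.2 < 0} := isOpen_lt continuous_snd continuous_const
  have hdisj : Disjoint {x : Cyl T | 0 < x.2} {x : Cyl T | x.2 < 0} :=
    disjoint_left.2 fun x (h : 0 < x.2) (h' : x.2 < 0) => lt_asymm h h'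
  have hcov : R ⊆ {x : Cyl T | 0 < x.2} ∪ {x : Cyl T | x.2 < 0} := fun y hy => by
    rcases lt_trichotomy y.2 0 with h | h | h
    · exact Or.inr h
    · exact absurd (Or.inl h) (hfree hy).2
    · exact Or.inl h
  have hlt : ∀ y ∈ R, -1 < y.2 ∧ y.2 < 1 := fun y hy => abs_lt.1 (hfree hy).1
  cases σ
  · have := hpre.subset_left_of_subset_union ho1 ho2 hdisj hcov ⟨x, hx, hxσ.1⟩
    exact fun y hy => ⟨this hy, (hlt y hy).2⟩
  · have := hpre.subset_right_of_subset_union ho1 ho2 hdisj hcov ⟨x, hx, hxσ.2⟩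
    exact fun y hy => ⟨(hlt y hy).1, this hy⟩

/-- Every point off `L` is in the closure of a region on each side. -/
theorem exists_region_at (hΨ : Ψ.Straightens L) (σ : Side) {z : ℝ × ℝ}
    (hz : z.2 ∈ Icc σ.lo σ.hi) (h : (Ψ.toFun z).2 ≠ 0) :
    ∃ R ∈ regions L, R ⊆ σ.strip T ∧ proj T z ∈ closure R := by
  obtain ⟨U, hU, hU0, hUd⟩ := exists_nhds_dichotomy hΨ σ h
  obtain ⟨y, hy, hyσ⟩ := exists_mem_strip_of_nhds hz hU
  obtain ⟨R, hR, hyR⟩ := exists_mem_regions (proj_mem_free hΨ hyσ (hU0 y hy))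
  have hRσ := subset_strip_of_mem hR hyR hyσ
  refine ⟨R, hR, hRσ, ?_⟩
  rcases hUd R hR hRσ with h1 | h1
  · exact h1.2 z (mem_of_mem_nhds hU) hz
  · exact absurd (subset_closure hyR) (h1 y hy)

theorem region_unique (hΨ : Ψ.Straightens L) {σ : Side} {z : ℝ × ℝ}
    (hz : z.2 ∈ Icc σ.lo σ.hi) (h : (Ψ.toFun z).2 ≠ 0) {R₁ R₂ : Set (Cyl T)}
    (h₁ : R₁ ∈ regions L) (h₂ : R₂ ∈ regions L) (hσ₁ : R₁ ⊆ σ.strip T) (hσ₂ : R₂ ⊆ σ.strip T)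
    (hz₁ : proj T z ∈ closure R₁) (hz₂ : proj T z ∈ closure R₂) : R₁ = R₂ := by
  obtain ⟨U, hU, hU0, hUd⟩ := exists_nhds_dichotomy hΨ σ h
  obtain ⟨y, hy, hyσ⟩ := exists_mem_strip_of_nhds hz hU
  have hzU := mem_of_mem_nhds hU
  refine regions_eq_of_nonempty h₁ h₂ ⟨proj T y, ?_, ?_⟩
  · exact ((hUd R₁ h₁ hσ₁).resolve_right fun h => h z hzU hz₁).1 y hy hyσ
  · exact ((hUd R₂ h₂ hσ₂).resolve_right fun h => h z hzU hz₂).1 y hy hyσ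

/-- An interval of the zero section without points of `L` touches a region on one side either
everywhere or nowhere. -/
theorem interval_subset_closure (hΨ : Ψ.Straightens L) {σ : Side} {R : Set (Cyl T)}
    (hR : R ∈ regions L) (hRσ : R ⊆ σ.strip T) {J : Set ℝ} (hJ : IsPreconnected J)
    (hJL : ∀ q ∈ J, (Ψ.toFun (q, 0)).2 ≠ 0) {q₀ : ℝ} (hq₀ : q₀ ∈ J)
    (h : pt T q₀ ∈ closure R) : ∀ q ∈ J, pt T q ∈ closure R := by
  have hcont : Continuous (pt T) := (continuous_proj T).comp (by fun_prop)
  set A : Set ℝ := pt T ⁻¹' closure R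
  have hA : IsClosed A := isClosed_closure.preimage hcont
  have hint : ∀ q ∈ J, q ∈ A → q ∈ interior A := by
    intro q hq hqA
    obtain ⟨U, hU, -, hUd⟩ := exists_nhds_dichotomy hΨ σ (hJL q hq)
    have h1 := (hUd R hR hRσ).resolve_right fun h => h _ (mem_of_mem_nhds hU) hqA
    rw [mem_interior_iff_mem_nhds]
    have h2 : ∀ᶠ x in 𝓝 q, (x, (0 : ℝ)) ∈ U :=
      (by fun_prop : Continuous fun x : ℝ => (x, (0 : ℝ))).continuousAt hU
    filter_upwards [h2] with x hx
    exact h1.2 _ hx σ.zero_mem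
  intro q hq
  suffices hJA : J ⊆ interior A from (interior_subset (hJA hq) : q ∈ A)
  refine hJ.subset_of_closure_inter_subset isOpen_interior ⟨q₀, hq₀, hint q₀ hq₀ h⟩ ?_
  rintro x ⟨hx, hxJ⟩
  exact hint x hxJ (hA.closure_subset_iff.2 interior_subset hx)

/-- A region lies on one side of `L`. -/
theorem exists_sign_of_region (hΨ : Ψ.Straightens L) {R : Set (Cyl T)} (hR : R ∈ regions L) :
    ∃ e : ℝ, e ≠ 0 ∧ ∀ z, proj T z ∈ closure R → 0 ≤ e * (Ψ.toFun z).2 := by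
  have hc : Continuous fun z => (Ψ.toFun z).2 := continuous_snd.comp Ψ.continuous_toFun
  have ho1 : IsOpen (proj T '' {z | 0 < (Ψ.toFun z).2}) :=
    isOpenMap_proj T _ (isOpen_lt continuous_const hc)
  have ho2 : IsOpen (proj T '' {z | (Ψ.toFun z).2 < 0}) :=
    isOpenMap_proj T _ (isOpen_lt hc continuous_const)
  have hper : ∀ z z', proj T z = proj T z' → (Ψ.toFun z').2 = (Ψ.toFun z).2 := by
    intro z z' h
    obtain ⟨m, rfl⟩ := proj_eq_iff.1 h
    simp [Ψ.toFun_add]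
  have hdisj : Disjoint (proj T '' {z | 0 < (Ψ.toFun z).2})
      (proj T '' {z | (Ψ.toFun z).2 < 0}) := by
    refine disjoint_left.2 ?_
    rintro _ ⟨z, hz, rfl⟩ ⟨z', hz', h⟩
    rw [mem_ofPred_eq] at hz hz'
    rw [hper _ _ h] at hz
    exact lt_asymm hz hz'
  have hcov : R ⊆ proj T '' {z | 0 < (Ψ.toFun z).2} ∪ proj T '' {z | (Ψ.toFun z).2 < 0} := by
    intro x hx
    obtain ⟨z, rfl⟩ := proj_surjective x
    rcases lt_trichotomy (Ψ.toFun z).2 0 with h | h | h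
    · exact Or.inr ⟨z, h, rfl⟩
    · exact absurd (Or.inr ((hΨ z).2 h)) (subset_free_of_mem_regions hR hx).2
    · exact Or.inl ⟨z, h, rfl⟩
  have key : ∀ e : ℝ, (∀ z, proj T z ∈ R → 0 ≤ e * (Ψ.toFun z).2) →
      ∀ z, proj T z ∈ closure R → 0 ≤ e * (Ψ.toFun z).2 := by
    intro e he z hz
    have h1 : z ∈ closure (proj T ⁻¹' R) := by
      rw [← (isOpenMap_proj T).preimage_closure_eq_closure_preimage (continuous_proj T)]
      exact hz
    have h2 : IsClosed {z | 0 ≤ e * (Ψ.toFun z).2} :=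
      isClosed_le continuous_const (hc.const_mul e)
    exact h2.closure_subset_iff.2 (fun z hz => he z hz) h1
  rcases (isPreconnected_of_mem_regions hR).subset_or_subset ho1 ho2 hdisj hcov with h | h
  · refine ⟨1, one_ne_zero, key 1 fun z hz => ?_⟩
    obtain ⟨z', hz', hzz⟩ := h hz
    rw [hper _ _ hzz, one_mul]
    exact le_of_lt hz'
  · refine ⟨-1, by norm_num, key (-1) fun z hz => ?_⟩
    obtain ⟨z', hz', hzz⟩ := h hz
    rw [hper _ _ hzz]
    have : (Ψ.toFun z').2 < 0 := hz'
    linarith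

theorem isRoot_of_mem_closure {R : Set (Cyl T)} {σ : Side} {q : ℝ}
    (h : proj T (q, σ.sgn) ∈ closure R) : IsRoot R := by
  intro c hc
  have ho : IsOpen {x : Cyl T | c < |x.2|} := isOpen_lt continuous_const (by fun_prop)
  obtain ⟨x, hx, hxR⟩ := mem_closure_iff.1 h _ ho
    (by simpa [proj, σ.abs_sgn] using hc)
  exact ⟨x, hxR, hx⟩

/-- A root contains a neighbourhood of the end of the annulus. -/
theorem collar_subset_of_isRoot (hΨ : Ψ.Straightens L) {σ : Side} {R : Set (Cyl T)}
    (hR : R ∈ regions L) (hRσ : R ⊆ σ.strip T) (hroot : IsRoot R) {c : ℝ} (hc0 : 0 ≤ c)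
    (hc1 : c < 1) (hc : ∀ z : ℝ × ℝ, c < |z.2| → Ψ.toFun z = z) {t : ℝ} (hct : c < t)
    (ht1 : t < 1) (q : ℝ) : proj T (q, σ.sgn * t) ∈ R := by
  have h2 : ∀ p : ℝ, c < p → |σ.sgn * p| = p := fun p hp => by
    rw [abs_mul, σ.abs_sgn, one_mul, abs_of_pos (hc0.trans_lt hp)]
  set A : Set (Cyl T) := (fun x : ℝ × ℝ => proj T (x.1, σ.sgn * x.2)) '' (univ ×ˢ Ioo c 1)
  have hA : IsPreconnected A := by
    refine (convex_univ.prod (convex_Ioo c 1)).isPreconnected.image _ ?_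
    exact ((continuous_proj T).comp (by fun_prop)).continuousOn
  have hAL : A ⊆ free L := by
    rintro _ ⟨x, ⟨-, hx⟩, rfl⟩
    have h1 : σ.sgn * x.2 ∈ Ioo σ.lo σ.hi := Side.sgn_mul_mem (hc0.trans_lt hx.1) hx.2
    refine proj_mem_free hΨ (σ := σ) h1 ?_
    rw [hc _ (by rw [h2 _ hx.1]; exact hx.1)]
    exact (Side.ne_zero_of_mem h1).1
  obtain ⟨x, hxR, hx⟩ := hroot c hc1
  obtain ⟨z, rfl⟩ := proj_surjective x
  have hzσ : z.2 ∈ Ioo σ.lo σ.hi := hRσ hxR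
  have hz1 : |z.2| < 1 := (Side.ne_zero_of_mem hzσ).2
  have hsgn : σ.sgn * |z.2| = z.2 := by
    cases σ <;> simp only [Side.lo, Side.hi, mem_Ioo] at hzσ
    · simp [Side.sgn, abs_of_pos hzσ.1]
    · simp [Side.sgn, abs_of_neg hzσ.2]
  have hne : (A ∩ R).Nonempty :=
    ⟨proj T z, ⟨(z.1, |z.2|), ⟨trivial, hx, hz1⟩, by simp only [hsgn]⟩, hxR⟩
  exact regions_subset_of_nonempty hR hA hAL hne ⟨(q, t), ⟨trivial, hct, ht1⟩, rfl⟩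

theorem mem_closure_of_isRoot (hΨ : Ψ.Straightens L) {σ : Side} {R : Set (Cyl T)}
    (hR : R ∈ regions L) (hRσ : R ⊆ σ.strip T) (hroot : IsRoot R) (q : ℝ) :
    proj T (q, σ.sgn) ∈ closure R := by
  obtain ⟨c, hc0, hc1, hc⟩ := Ψ.eq_self
  have h1 : Tendsto (fun t : ℝ => proj T (q, σ.sgn * t)) (𝓝[<] 1) (𝓝 (proj T (q, σ.sgn))) := by
    have : Continuous fun t : ℝ => proj T (q, σ.sgn * t) := (continuous_proj T).comp (by fun_prop)
    have := this.tendsto 1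
    rw [mul_one] at this
    exact this.mono_left nhdsWithin_le_nhds
  refine mem_closure_of_tendsto h1 ?_
  filter_upwards [Ioo_mem_nhdsLT hc1] with t ht
  exact collar_subset_of_isRoot hΨ hR hRσ hroot hc0 hc1 hc ht.1 ht.2 q

/-- Being a root becomes contact with the end circle, all of it or none. The end circle can then be
treated as an edge of the rectangle of integration. -/
theorem mem_closure_iff_isRoot (hΨ : Ψ.Straightens L) {σ : Side} {R : Set (Cyl T)}
    (hR : R ∈ regions L) (hRσ : R ⊆ σ.strip T) (q : ℝ) :
    proj T (q, σ.sgn) ∈ closure R ↔ IsRoot R :=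
  ⟨isRoot_of_mem_closure, fun h => mem_closure_of_isRoot hΨ hR hRσ h q⟩

end local_structure

/-! ### Stokes' theorem for a region. -/

/-- An approximation of the identity function that vanishes to third order at `0`. -/
noncomputable def flat (δ x : ℝ) : ℝ := x ^ 3 / (x ^ 2 + δ ^ 2)

/-- The derivative of `flat`. -/
noncomputable def flatDeriv (δ x : ℝ) : ℝ := (x ^ 4 + 3 * x ^ 2 * δ ^ 2) / (x ^ 2 + δ ^ 2) ^ 2

theorem hasDerivAt_flat {δ : ℝ} (hδ : 0 < δ) (x : ℝ) :
    HasDerivAt (flat δ) (flatDeriv δ x) x := by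
  have h0 : x ^ 2 + δ ^ 2 ≠ 0 := by positivity
  have h1 := (hasDerivAt_pow 3 x).div ((hasDerivAt_pow 2 x).add_const (δ ^ 2)) h0
  refine h1.congr_deriv ?_
  rw [flatDeriv]
  congr 1
  norm_num
  ring

theorem continuous_flat {δ : ℝ} (hδ : 0 < δ) : Continuous (flat δ) :=
  continuous_iff_continuousAt.2 fun x => (hasDerivAt_flat hδ x).continuousAt

theorem continuous_flatDeriv {δ : ℝ} (hδ : 0 < δ) : Continuous (flatDeriv δ) := by
  unfold flatDeriv
  refine Continuous.div (by fun_prop) (by fun_prop) fun x => ?_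
  positivity

theorem abs_flat_le (δ x : ℝ) : |flat δ x| ≤ |x| := by
  rcases eq_or_ne x 0 with rfl | hx
  · simp [flat]
  · have : 0 < x ^ 2 + δ ^ 2 := by positivity
    rw [flat, abs_div, abs_of_pos this, div_le_iff₀ this, abs_pow, ← sq_abs x]
    nlinarith [mul_nonneg (abs_nonneg x) (sq_nonneg δ)]

theorem abs_flatDeriv_le (δ x : ℝ) : |flatDeriv δ x| ≤ 3 := by
  rcases eq_or_ne x 0 with rfl | hx
  · simp [flatDeriv]
  · have : 0 < x ^ 2 + δ ^ 2 := by positivity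
    have h1 : 0 ≤ flatDeriv δ x := by unfold flatDeriv; positivity
    rw [abs_of_nonneg h1, flatDeriv, div_le_iff₀ (by positivity)]
    nlinarith [sq_nonneg (x ^ 2), sq_nonneg (δ ^ 2), mul_nonneg (sq_nonneg x) (sq_nonneg δ)]

theorem tendsto_flat (x : ℝ) : Tendsto (fun n : ℕ => flat (1 / (n + 1)) x) atTop (𝓝 x) := by
  rcases eq_or_ne x 0 with rfl | hx
  · simp [flat]
  · have h1 : ContinuousAt (fun δ => flat δ x) 0 := by
      unfold flat
      refine ContinuousAt.div (by fun_prop) (by fun_prop) (by simpa using hx)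
    have h2 := h1.tendsto.comp (tendsto_one_div_add_atTop_nhds_zero_nat (𝕜 := ℝ))
    have h3 : flat 0 x = x := by simp only [flat]; field_simp; ring
    rw [h3] at h2
    exact h2

/-- The limit is `0`, not `1`, at the origin. The limiting area integral therefore omits `L`, and
`L` need not be shown to be a null set. -/
theorem tendsto_flatDeriv (x : ℝ) : Tendsto (fun n : ℕ => flatDeriv (1 / (n + 1)) x) atTop
    (𝓝 (({0}ᶜ : Set ℝ).indicator 1 x)) := by
  rcases eq_or_ne x 0 with rfl | hx
  · simp [flatDeriv]
  · have h1 : ContinuousAt (fun δ => flatDeriv δ x) 0 := by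
      unfold flatDeriv
      refine ContinuousAt.div (by fun_prop) (by fun_prop) (by simpa using hx)
    have h2 := h1.tendsto.comp (tendsto_one_div_add_atTop_nhds_zero_nat (𝕜 := ℝ))
    have h3 : flatDeriv 0 x = 1 := by simp only [flatDeriv]; field_simp; ring
    rw [h3] at h2
    simpa [hx, Function.comp_def] using h2

/-- Either the set is locally constant at `z`, or `f` vanishes to first order there; in the latter
case the truncated function is bounded by `|f|` and is still `o(‖y - z‖)`. -/
theorem hasFDerivAt_indicator {E : Type*} [NormedAddCommGroup E] [NormedSpace ℝ E] {S : Set E}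
    {z : E} {f : E → ℝ} {f' : E →L[ℝ] ℝ} (hf : HasFDerivAt f f' z)
    (h : (∀ᶠ y in 𝓝 z, y ∈ S ↔ z ∈ S) ∨ (f z = 0 ∧ f' = 0)) :
    HasFDerivAt (S.indicator f) (S.indicator (fun _ => f') z) z := by
  rcases h with h | ⟨h0, rfl⟩
  · by_cases hz : z ∈ S
    · rw [indicator_of_mem hz]
      refine hf.congr_of_eventuallyEq ?_
      filter_upwards [h] with y hy
      exact indicator_of_mem (hy.2 hz) f
    · rw [indicator_of_notMem hz]
      refine (hasFDerivAt_const (0 : ℝ) z).congr_of_eventuallyEq ?_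
      filter_upwards [h] with y hy
      exact indicator_of_notMem (fun hh => hz (hy.1 hh)) f
  · have h1 : S.indicator (fun _ : E => (0 : E →L[ℝ] ℝ)) z = 0 := by simp
    have h2 : S.indicator f z = 0 := by simp [indicator, h0]
    rw [h1]
    rw [hasFDerivAt_iff_isLittleO] at hf ⊢
    simp only [h0, h2, zero_apply, sub_zero] at hf ⊢
    refine Asymptotics.IsBigO.trans_isLittleO ?_ hf
    exact Asymptotics.IsBigO.of_bound 1 (Eventually.of_forall fun y => by
      rw [one_mul]; exact norm_indicator_le_norm_self f y)

theorem continuousWithinAt_indicator {E : Type*} [TopologicalSpace E] {S : Set E} {z : E}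
    {f : E → ℝ} {Q : Set E} (hf : ContinuousWithinAt f Q z)
    (h : (∀ᶠ y in 𝓝[Q] z, y ∈ S ↔ z ∈ S) ∨ f z = 0) :
    ContinuousWithinAt (S.indicator f) Q z := by
  rcases h with h | h0
  · by_cases hz : z ∈ S
    · refine hf.congr_of_eventuallyEq ?_ (indicator_of_mem hz f)
      filter_upwards [h] with y hy
      exact indicator_of_mem (hy.2 hz) f
    · refine (continuousWithinAt_const (b := (0 : ℝ))).congr_of_eventuallyEq ?_
        (indicator_of_notMem hz f)
      filter_upwards [h] with y hy
      exact indicator_of_notMem (fun hh => hz (hy.1 hh)) f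
  · have h2 : S.indicator f z = 0 := by simp [indicator, h0]
    rw [ContinuousWithinAt, h2]
    rw [ContinuousWithinAt, h0] at hf
    exact squeeze_zero_norm (fun y => norm_indicator_le_norm_self f y) (by simpa using hf.norm)

variable {T : ℝ} {L R : Set (Cyl T)} {Ψ : ExactLift T}

theorem eventually_mem_closure_iff (hΨ : Ψ.Straightens L) {σ : Side} (hR : R ∈ regions L)
    (hRσ : R ⊆ σ.strip T) {z : ℝ × ℝ} (hz : z.2 ∈ Icc σ.lo σ.hi) (h : (Ψ.toFun z).2 ≠ 0) :
    ∀ᶠ y in 𝓝[Prod.snd ⁻¹' Icc σ.lo σ.hi] z,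
      (y ∈ proj T ⁻¹' closure R ↔ z ∈ proj T ⁻¹' closure R) := by
  obtain ⟨U, hU, -, hUd⟩ := exists_nhds_dichotomy hΨ σ h
  filter_upwards [mem_nhdsWithin_of_mem_nhds hU, self_mem_nhdsWithin] with y hy hyσ
  rcases hUd R hR hRσ with h1 | h1
  · exact iff_of_true (h1.2 y hy hyσ) (h1.2 z (mem_of_mem_nhds hU) hz)
  · exact iff_of_false (h1 y hy) (h1 z (mem_of_mem_nhds hU))

theorem fderiv_add_period (Ψ : ExactLift T) (z : ℝ × ℝ) :
    fderiv ℝ Ψ.toFun (z + (T, 0)) = fderiv ℝ Ψ.toFun z := by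
  rw [← fderiv_comp_add_right]
  have : (fun z => Ψ.toFun (z + (T, 0))) = fun z => Ψ.toFun z + (T, 0) := funext Ψ.equivariant
  rw [this, fderiv_add_const]

/-- With `Ψ = (Q, ρ)`, the form `ρ dQ` cut off outside the region is continuous but need not be
differentiable at `L`. Replacing `ρ` by `flat δ ρ`, which vanishes on `L` with its derivative, makes
the cut-off form differentiable across `L` with no knowledge of the boundary of the region. The
divergence theorem on one period of the strip then applies, and the two vertical sides cancel by
periodicity. -/
theorem divergence_formula (hT : 0 < T) (hΨ : Ψ.Straightens L) {σ : Side} (hR : R ∈ regions L)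
    (hRσ : R ⊆ σ.strip T) {δ : ℝ} (hδ : 0 < δ) (a : ℝ) :
    ∫ z in Icc (a, σ.lo) (a + T, σ.hi),
        (proj T ⁻¹' closure R).indicator (fun z => flatDeriv δ (Ψ.toFun z).2) z
      = (∫ q in a..a + T, (proj T ⁻¹' closure R).indicator
          (fun z => flat δ (Ψ.toFun z).2 * (fderiv ℝ Ψ.toFun z (1, 0)).1) (q, σ.hi))
        - ∫ q in a..a + T, (proj T ⁻¹' closure R).indicator
          (fun z => flat δ (Ψ.toFun z).2 * (fderiv ℝ Ψ.toFun z (1, 0)).1) (q, σ.lo) := by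
  set S := proj T ⁻¹' closure R with hS
  have hSm : MeasurableSet S := (isClosed_closure.preimage (continuous_proj T)).measurableSet
  have cΨ := Ψ.continuous_toFun
  have cD := Ψ.continuous_fderiv
  have cρ : Continuous fun z => (Ψ.toFun z).2 := continuous_snd.comp cΨ
  have hD1 : ContDiff ℝ 1 (fderiv ℝ Ψ.toFun) := Ψ.contDiff_toFun.fderiv_right (by norm_cast)
  set D2 := fun z => fderiv ℝ (fderiv ℝ Ψ.toFun) z
  have hD2 : ∀ z, HasFDerivAt (fderiv ℝ Ψ.toFun) (D2 z) z := fun z =>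
    ((hD1.differentiable one_ne_zero) z).hasFDerivAt
  set ρ' : ℝ × ℝ → (ℝ × ℝ →L[ℝ] ℝ) := fun z =>
    (ContinuousLinearMap.snd ℝ ℝ ℝ).comp (fderiv ℝ Ψ.toFun z)
  have hρ : ∀ z, HasFDerivAt (fun z => (Ψ.toFun z).2) (ρ' z) z := fun z =>
    hasFDerivAt_snd.comp z (Ψ.hasFDerivAt z)
  have hflat : ∀ z, HasFDerivAt (fun z => flat δ (Ψ.toFun z).2)
      (flatDeriv δ (Ψ.toFun z).2 • ρ' z) z := fun z =>
    (hasDerivAt_flat hδ _).comp_hasFDerivAt z (hρ z)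
  set G : ℝ × ℝ → ℝ × ℝ → ℝ := fun e z => flat δ (Ψ.toFun z).2 * (fderiv ℝ Ψ.toFun z e).1
  set G' : ℝ × ℝ → ℝ × ℝ → (ℝ × ℝ →L[ℝ] ℝ) := fun e z =>
    flat δ (Ψ.toFun z).2 • (ContinuousLinearMap.fst ℝ ℝ ℝ).comp ((D2 z).flip e)
      + (fderiv ℝ Ψ.toFun z e).1 • (flatDeriv δ (Ψ.toFun z).2 • ρ' z)
  have hG : ∀ e z, HasFDerivAt (G e) (G' e z) z := by
    intro e z
    have h1 : HasFDerivAt (fun z => (fderiv ℝ Ψ.toFun z e).1)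
        ((ContinuousLinearMap.fst ℝ ℝ ℝ).comp ((D2 z).flip e)) z := by
      have := (hD2 z).clm_apply (hasFDerivAt_const e z)
      simp only [ContinuousLinearMap.comp_zero, zero_add] at this
      exact hasFDerivAt_fst.comp z this
    exact (hflat z).mul h1
  have hG0 : ∀ e z, (Ψ.toFun z).2 = 0 → G e z = 0 ∧ G' e z = 0 := by
    intro e z hz
    simp [G, G', hz, flat, flatDeriv]
  have cG : ∀ e, Continuous (G e) := fun e =>
    continuous_iff_continuousAt.2 fun z => (hG e z).continuousAt
  have hQ : Icc (a, σ.lo) (a + T, σ.hi) ⊆ Prod.snd ⁻¹' Icc σ.lo σ.hi := fun z hz =>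
    ⟨hz.1.2, hz.2.2⟩
  have hcont : ∀ e, ContinuousOn (S.indicator (G e)) (Icc (a, σ.lo) (a + T, σ.hi)) := by
    intro e z hz
    refine ContinuousWithinAt.mono ?_ hQ
    refine continuousWithinAt_indicator (cG e).continuousWithinAt ?_
    by_cases h : (Ψ.toFun z).2 = 0
    · exact Or.inr (hG0 e z h).1
    · exact Or.inl (eventually_mem_closure_iff hΨ hR hRσ (hQ hz) h)
  have hdiff : ∀ e, ∀ z ∈ Ioo a (a + T) ×ˢ Ioo σ.lo σ.hi,
      HasFDerivAt (S.indicator (G e)) (S.indicator (G' e) z) z := by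
    intro e z hz
    refine hasFDerivAt_indicator (hG e z) ?_
    by_cases h : (Ψ.toFun z).2 = 0
    · exact Or.inr (hG0 e z h)
    · left
      have := eventually_mem_closure_iff hΨ hR hRσ (Ioo_subset_Icc_self hz.2) h
      rwa [nhdsWithin_eq_nhds.2] at this
      exact mem_of_superset (continuous_snd.continuousAt.preimage_mem_nhds
        (isOpen_Ioo.mem_nhds hz.2)) (preimage_mono Ioo_subset_Icc_self)
  -- The second derivatives of `Q` cancel by symmetry; the remaining factor is the Jacobian of `Ψ`,
  -- which is one.
  have hdiv : ∀ z, -(S.indicator (G' (0, 1)) z) (1, 0) + (S.indicator (G' (1, 0)) z) (0, 1)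
      = S.indicator (fun z => flatDeriv δ (Ψ.toFun z).2) z := by
    intro z
    by_cases hz : z ∈ S
    · simp only [indicator_of_mem hz]
      have h1 := second_derivative_symmetric Ψ.hasFDerivAt (hD2 z) (1, 0) (0, 1)
      have h2 := Ψ.det_eq_one z
      simp only [G', ρ', add_apply, smul_apply, ContinuousLinearMap.comp_apply, smul_eq_mul,
        ContinuousLinearMap.coe_fst', ContinuousLinearMap.coe_snd',
        ContinuousLinearMap.flip_apply]
      rw [h1]
      linear_combination flatDeriv δ (Ψ.toFun z).2 * h2
    · simp [indicator_of_notMem hz]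
  have hmain := integral_divergence_prod_Icc_of_hasFDerivAt_of_le
    (fun z => -S.indicator (G (0, 1)) z) (S.indicator (G (1, 0)))
    (fun z => -S.indicator (G' (0, 1)) z) (S.indicator (G' (1, 0)))
    (a, σ.lo) (a + T, σ.hi) ⟨by simpa using hT.le, σ.lo_lt_hi.le⟩ (hcont _).neg (hcont _)
    (fun z hz => (hdiff _ z hz).neg) (hdiff _) (by
      simp only [neg_apply, hdiv]
      refine IntegrableOn.indicator ?_ hSm
      exact ((continuous_flatDeriv hδ).comp cρ).continuousOn.integrableOn_compact isCompact_Icc)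
  simp only [neg_apply, hdiv] at hmain
  rw [hmain]
  have hper : ∀ y, S.indicator (G (0, 1)) (a + T, y) = S.indicator (G (0, 1)) (a, y) := by
    intro y
    have h0 : ((a + T, y) : ℝ × ℝ) = (a, y) + (T, 0) := by simp
    have h1 : (a + T, y) ∈ S ↔ (a, y) ∈ S := by
      have := proj_add_period T 1 (a, y)
      rw [Int.cast_one, one_mul, ← h0] at this
      simp [hS, this]
    have h2 : G (0, 1) (a + T, y) = G (0, 1) (a, y) := by
      simp only [G]
      rw [h0, fderiv_add_period, Ψ.equivariant]
      simp
    by_cases hy : (a, y) ∈ S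
    · rw [indicator_of_mem hy, indicator_of_mem (h1.2 hy), h2]
    · rw [indicator_of_notMem hy, indicator_of_notMem fun h => hy (h1.1 h)]
  simp only [hper]
  rw [add_sub_cancel_right]

theorem tendsto_edge_integral (Ψ : ExactLift T) {S : Set (ℝ × ℝ)} (hS : MeasurableSet S)
    (a b p : ℝ) :
    Tendsto (fun n : ℕ => ∫ q in a..b, S.indicator (fun z => flat (1 / (n + 1)) (Ψ.toFun z).2
        * (fderiv ℝ Ψ.toFun z (1, 0)).1) (q, p)) atTop
      (𝓝 (∫ q in a..b, S.indicator (fun z => (Ψ.toFun z).2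
        * (fderiv ℝ Ψ.toFun z (1, 0)).1) (q, p))) := by
  have cΨ := Ψ.continuous_toFun
  have cD := Ψ.continuous_fderiv
  have cl : Continuous fun q : ℝ => (q, p) := by fun_prop
  refine intervalIntegral.tendsto_integral_filter_of_dominated_convergence
    (fun q => |(Ψ.toFun (q, p)).2 * (fderiv ℝ Ψ.toFun (q, p) (1, 0)).1|) ?_ ?_ ?_ ?_
  · refine Eventually.of_forall fun n => ?_
    have hn : (0 : ℝ) < 1 / (n + 1) := by positivity
    have h1 : Continuous fun z => flat (1 / (n + 1)) (Ψ.toFun z).2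
        * (fderiv ℝ Ψ.toFun z (1, 0)).1 :=
      ((continuous_flat hn).comp (continuous_snd.comp cΨ)).mul (by fun_prop)
    exact ((h1.measurable.indicator hS).comp cl.measurable).aestronglyMeasurable
  · refine Eventually.of_forall fun n => Eventually.of_forall fun q _ => ?_
    refine (norm_indicator_le_norm_self _ _).trans ?_
    rw [Real.norm_eq_abs, abs_mul, abs_mul]
    exact mul_le_mul_of_nonneg_right (abs_flat_le _ _) (abs_nonneg _)
  · refine Continuous.intervalIntegrable ?_ _ _
    have h1 : Continuous fun z => |(Ψ.toFun z).2 * (fderiv ℝ Ψ.toFun z (1, 0)).1| := by fun_prop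
    exact h1.comp cl
  · refine Eventually.of_forall fun q _ => ?_
    by_cases hq : (q, p) ∈ S
    · simp only [indicator_of_mem hq]
      exact (tendsto_flat _).mul_const _
    · simp [indicator_of_notMem hq]

theorem tendsto_area_integral (Ψ : ExactLift T) {S : Set (ℝ × ℝ)} (hS : MeasurableSet S)
    (A B : ℝ × ℝ) :
    Tendsto (fun n : ℕ => ∫ z in Icc A B,
        S.indicator (fun z => flatDeriv (1 / (n + 1)) (Ψ.toFun z).2) z) atTop
      (𝓝 (∫ z in Icc A B, (S ∩ {z | (Ψ.toFun z).2 ≠ 0}).indicator 1 z)) := by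
  have cρ : Continuous fun z => (Ψ.toFun z).2 := continuous_snd.comp Ψ.continuous_toFun
  refine tendsto_integral_of_dominated_convergence (fun _ => 3) ?_ ?_ ?_ ?_
  · intro n
    have hn : (0 : ℝ) < 1 / (n + 1) := by positivity
    exact ((((continuous_flatDeriv hn).comp cρ).measurable).indicator hS).aestronglyMeasurable
  · exact integrableOn_const isCompact_Icc.measure_lt_top.ne
  · refine fun n => Eventually.of_forall fun z => ?_
    exact (norm_indicator_le_norm_self _ _).trans (abs_flatDeriv_le _ _)
  · refine Eventually.of_forall fun z => ?_
    by_cases hz : z ∈ S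
    · have := tendsto_flatDeriv (Ψ.toFun z).2
      simp only [indicator_of_mem hz]
      convert this using 2
      by_cases h0 : (Ψ.toFun z).2 = 0 <;> simp [indicator, hz, h0]
    · simp [hz]

variable [Fact (0 < T)]

theorem volume_eq_volume_preimage (hR : MeasurableSet R) (a : ℝ) :
    volume R = volume (Ioc a (a + T) ×ˢ univ ∩ proj T ⁻¹' R) := by
  have h1 : MeasurePreserving (proj T) ((volume.restrict (Ioc a (a + T))).prod volume) volume :=
    (AddCircle.measurePreserving_mk T a).prod (MeasurePreserving.id volume)
  rw [← h1.measure_preimage hR.nullMeasurableSet]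
  have h2 : (volume.restrict (Ioc a (a + T))).prod (volume : Measure ℝ)
      = (volume : Measure (ℝ × ℝ)).restrict (Ioc a (a + T) ×ˢ univ) := by
    have h3 := Measure.prod_restrict (μ := (volume : Measure ℝ)) (ν := (volume : Measure ℝ))
      (Ioc a (a + T)) univ
    rw [Measure.restrict_univ] at h3
    exact h3
  rw [h2, Measure.restrict_apply (hR.preimage (continuous_proj T).measurable), inter_comm]

/-- Off `L` and inside the open strip, a point of the closure of a region already belongs to it. Up
to the sides of the rectangle, which are null, the two sets coincide. -/
theorem area_eq_setIntegral (hΨ : Ψ.Straightens L) {σ : Side} (hR : R ∈ regions L)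
    (hRσ : R ⊆ σ.strip T) (a : ℝ) :
    area R = ∫ z in Icc (a, σ.lo) (a + T, σ.hi),
      (proj T ⁻¹' closure R ∩ {z | (Ψ.toFun z).2 ≠ 0}).indicator (1 : ℝ × ℝ → ℝ) z := by
  set A := proj T ⁻¹' closure R ∩ {z | (Ψ.toFun z).2 ≠ 0}
  have hρm : MeasurableSet {z | (Ψ.toFun z).2 ≠ 0} :=
    (isOpen_ne_fun (continuous_snd.comp Ψ.continuous_toFun) continuous_const).measurableSet
  have hA : MeasurableSet A :=
    (isClosed_closure.preimage (continuous_proj T)).measurableSet.inter hρm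
  rw [integral_indicator_one hA, area, Measure.real, Measure.restrict_apply hA,
    volume_eq_volume_preimage (isOpen_of_mem_regions hΨ.isClosed hR).measurableSet a]
  congr 1
  refine measure_congr ?_
  have n1 : ∀ᵐ z : ℝ × ℝ, z.1 ≠ a :=
    Measure.quasiMeasurePreserving_fst.ae (Measure.ae_ne volume a)
  have n2 : ∀ᵐ z : ℝ × ℝ, z.2 ≠ σ.lo :=
    Measure.quasiMeasurePreserving_snd.ae (Measure.ae_ne volume σ.lo)
  have n3 : ∀ᵐ z : ℝ × ℝ, z.2 ≠ σ.hi :=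
    Measure.quasiMeasurePreserving_snd.ae (Measure.ae_ne volume σ.hi)
  filter_upwards [n1, n2, n3] with z h1 h2 h3
  refine propext ⟨?_, ?_⟩
  · rintro ⟨⟨hz, -⟩, hzR⟩
    have hzσ : z.2 ∈ Ioo σ.lo σ.hi := hRσ hzR
    refine ⟨⟨subset_closure hzR, fun h0 => ?_⟩, ⟨hz.1.le, hzσ.1.le⟩, hz.2, hzσ.2.le⟩
    exact (subset_free_of_mem_regions hR hzR).2 (Or.inr ((hΨ z).2 h0))
  · rintro ⟨⟨hzR, h0⟩, hz⟩
    have hzσ : z.2 ∈ Ioo σ.lo σ.hi := ⟨hz.1.2.lt_of_ne h2.symm, hz.2.2.lt_of_ne h3⟩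
    refine ⟨⟨⟨hz.1.1.lt_of_ne h1.symm, hz.2.1⟩, trivial⟩, ?_⟩
    obtain ⟨U, hU, -, hUd⟩ := exists_nhds_dichotomy hΨ σ h0
    have hzU := mem_of_mem_nhds hU
    exact ((hUd R hR hRσ).resolve_right fun h => h z hzU hzR).1 z hzU hzσ

open Classical in
/-- Stokes' theorem for a region, with a primitive of the area form that vanishes on `L`: only the
segments of the zero section and the ends of the annulus contribute. -/
theorem area_eq (hΨ : Ψ.Straightens L) {σ : Side} (hR : R ∈ regions L)
    (hRσ : R ⊆ σ.strip T) (a : ℝ) :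
    area R = (if IsRoot R then T else 0)
      - σ.sgn * ∫ q in a..a + T, (pt T ⁻¹' closure R).indicator Ψ.dens q := by
  have hT : 0 < T := Fact.out
  set S := proj T ⁻¹' closure R with hS
  have hSm : MeasurableSet S := (isClosed_closure.preimage (continuous_proj T)).measurableSet
  have h1 : area R = (∫ q in a..a + T, S.indicator (fun z => (Ψ.toFun z).2
        * (fderiv ℝ Ψ.toFun z (1, 0)).1) (q, σ.hi))
      - ∫ q in a..a + T, S.indicator (fun z => (Ψ.toFun z).2
        * (fderiv ℝ Ψ.toFun z (1, 0)).1) (q, σ.lo) := by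
    rw [area_eq_setIntegral hΨ hR hRσ a]
    refine tendsto_nhds_unique (tendsto_area_integral Ψ hSm _ _) ?_
    have h2 := (tendsto_edge_integral Ψ hSm a (a + T) σ.hi).sub
      (tendsto_edge_integral Ψ hSm a (a + T) σ.lo)
    refine h2.congr fun n => ?_
    exact (divergence_formula hT hΨ hR hRσ (by positivity) a).symm
  have h0 : (∫ q in a..a + T, S.indicator (fun z => (Ψ.toFun z).2
        * (fderiv ℝ Ψ.toFun z (1, 0)).1) (q, 0))
      = ∫ q in a..a + T, (pt T ⁻¹' closure R).indicator Ψ.dens q := rfl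
  have hend : (∫ q in a..a + T, S.indicator (fun z => (Ψ.toFun z).2
        * (fderiv ℝ Ψ.toFun z (1, 0)).1) (q, σ.sgn)) = σ.sgn * if IsRoot R then T else 0 := by
    have h2 : ∀ q, S.indicator (fun z => (Ψ.toFun z).2 * (fderiv ℝ Ψ.toFun z (1, 0)).1) (q, σ.sgn)
        = if IsRoot R then σ.sgn else 0 := by
      intro q
      obtain ⟨c, hc0, hc1, hc⟩ := Ψ.eq_self
      have h3 : c < |((q, σ.sgn) : ℝ × ℝ).2| := by simpa [σ.abs_sgn] using hc1
      -- Near the end `Ψ` is the identity, so `Ψ^*λ = p dq` has coefficient `σ.sgn` on the end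
      -- circle.
      have h4 : Ψ.toFun =ᶠ[𝓝 (q, σ.sgn)] id := by
        have : ∀ᶠ y : ℝ × ℝ in 𝓝 (q, σ.sgn), c < |y.2| :=
          (isOpen_lt continuous_const (by fun_prop : Continuous fun y : ℝ × ℝ => |y.2|)).mem_nhds
            h3
        filter_upwards [this] with y hy
        exact hc y hy
      have h5 : (q, σ.sgn) ∈ S ↔ IsRoot R := mem_closure_iff_isRoot hΨ hR hRσ q
      simp [indicator, h5, h4.fderiv_eq, hc _ h3]
    simp only [h2, intervalIntegral.integral_const]
    split_ifs <;> simp [mul_comm]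
  rw [h1]
  cases σ
  · simp only [Side.hi, Side.lo, Side.sgn] at hend ⊢
    rw [hend, h0]
    ring
  · simp only [Side.hi, Side.lo, Side.sgn] at hend ⊢
    rw [hend, h0]
    ring

/-! ### Periodic indexing of the intersection points. -/

namespace IsEnumeration

variable {T : ℝ} {L : Set (Cyl T)} {n : ℕ} {s : ℤ → ℝ}

theorem add_period (hs : IsEnumeration L n s) (i m : ℤ) : s (i + 2 * n * m) = s i + m * T := by
  induction m using Int.induction_on with
  | zero => simp
  | succ m ih =>
    rw [show i + 2 * (n : ℤ) * (m + 1) = (i + 2 * n * m) + 2 * n by ring, hs.periodic, ih]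
    push_cast; ring
  | pred m ih =>
    have h1 := hs.periodic (i + 2 * n * (-m - 1))
    rw [show i + 2 * (n : ℤ) * (-m - 1) + 2 * n = i + 2 * n * (-m) by ring, ih] at h1
    push_cast at h1 ⊢
    linarith

theorem pt_add_period (hs : IsEnumeration L n s) (i m : ℤ) :
    pt T (s (i + 2 * n * m)) = pt T (s i) := by
  have := proj_add_period T m (s i, 0)
  simp only [Prod.mk_add_mk, add_zero] at this
  rw [hs.add_period, pt, this, pt]

theorem pt_eq_pt_iff {q q' : ℝ} : pt T q = pt T q' ↔ ∃ m : ℤ, q' = q + m * T := by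
  rw [pt, pt, proj_eq_iff]
  simp [Prod.ext_iff]

theorem pt_mem_iff (hs : IsEnumeration L n s) (q : ℝ) : pt T q ∈ L ↔ ∃ i, q = s i := by
  have h1 : pt T q ∈ L ↔ pt T q ∈ zeroSection T ∩ L :=
    ⟨fun h => ⟨pt_mem_zeroSection q, h⟩, fun h => h.2⟩
  rw [h1, ← hs.range_eq]
  constructor
  · rintro ⟨i, hi⟩
    obtain ⟨m, rfl⟩ := pt_eq_pt_iff.1 hi
    exact ⟨i + 2 * n * m, (hs.add_period i m).symm⟩
  · rintro ⟨i, rfl⟩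
    exact ⟨i, rfl⟩

theorem pt_mem (hs : IsEnumeration L n s) (i : ℤ) : pt T (s i) ∈ L := (hs.pt_mem_iff _).2 ⟨i, rfl⟩

theorem pt_s_eq_iff (hs : IsEnumeration L n s) {i l : ℤ} :
    pt T (s i) = pt T (s l) ↔ ∃ m : ℤ, l = i + 2 * n * m := by
  rw [pt_eq_pt_iff]
  refine exists_congr fun m => ?_
  rw [← hs.add_period, hs.strictMono.injective.eq_iff]

theorem lt_succ (hs : IsEnumeration L n s) (i : ℤ) : s i < s (i + 1) :=
  hs.strictMono (lt_add_one i)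

theorem pt_notMem (hs : IsEnumeration L n s) {i : ℤ} {q : ℝ} (hq : q ∈ Ioo (s i) (s (i + 1))) :
    pt T q ∉ L := by
  intro h
  obtain ⟨l, rfl⟩ := (hs.pt_mem_iff q).1 h
  have h1 := hs.strictMono.lt_iff_lt.1 hq.1
  have h2 := hs.strictMono.lt_iff_lt.1 hq.2
  omega

theorem segment_add_period (hs : IsEnumeration L n s) (i m : ℤ) :
    segment T s (i + 2 * n * m) = segment T s i := by
  have key : ∀ i m : ℤ, segment T s (i + 2 * n * m) ⊆ segment T s i := by
    rintro i m _ ⟨q, hq, rfl⟩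
    rw [show i + 2 * (n : ℤ) * m + 1 = (i + 1) + 2 * n * m by ring, hs.add_period,
      hs.add_period] at hq
    refine ⟨q - m * T, ⟨by linarith [hq.1], by linarith [hq.2]⟩, ?_⟩
    exact pt_eq_pt_iff.2 ⟨m, by ring⟩
  refine (key i m).antisymm ?_
  have := key (i + 2 * n * m) (-m)
  rwa [show i + 2 * (n : ℤ) * m + 2 * n * (-m) = i by ring] at this

end IsEnumeration

open IsEnumeration

/-! ### Edges of the graph. -/

section joins

variable {T : ℝ} {L : Set (Cyl T)} {Ψ : ExactLift T} {n : ℕ} {s : ℤ → ℝ}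

theorem subset_strip_iff {R : Set (Cyl T)} (hR : R ∈ regions L) :
    (R ⊆ Side.above.strip T ↔ ∀ x ∈ R, 0 < x.2) ∧ (R ⊆ Side.below.strip T ↔ ∀ x ∈ R, x.2 < 0) := by
  have h : ∀ x ∈ R, |x.2| < 1 := fun x hx => (subset_free_of_mem_regions hR hx).1
  exact ⟨⟨fun hh x hx => (hh hx).1, fun hh x hx => ⟨hh x hx, (abs_lt.1 (h x hx)).2⟩⟩,
    ⟨fun hh x hx => (hh hx).2, fun hh x hx => ⟨(abs_lt.1 (h x hx)).1, hh x hx⟩⟩⟩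

/-- This form is uniform in the side, so that the two cases of the theorem share one argument. -/
theorem joins_iff {σ : Side} {i : ℤ} {R R' : Set (Cyl T)} :
    Joins L s σ i R R' ↔ R ∈ regions L ∧ R' ∈ regions L ∧ R ⊆ σ.strip T ∧ R' ⊆ σ.opp.strip T ∧
      segment T s i ⊆ closure R ∧ segment T s i ⊆ closure R' := by
  cases σ <;> simp only [Joins, IsEdge, Side.opp]
  · refine and_congr_right fun h1 => and_congr_right fun h2 => ?_
    rw [(subset_strip_iff h1).1, (subset_strip_iff h2).2]
  · rw [and_left_comm]
    refine and_congr_right fun h1 => and_congr_right fun h2 => ?_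
    rw [(subset_strip_iff h1).2, (subset_strip_iff h2).1]
    tauto

theorem toFun_ne_zero (hΨ : Ψ.Straightens L) {q : ℝ} (h : pt T q ∉ L) :
    (Ψ.toFun (q, 0)).2 ≠ 0 := fun h0 => h ((hΨ.pt_mem q).2 h0)

theorem segment_subset_closure (hΨ : Ψ.Straightens L) {σ : Side} {R : Set (Cyl T)}
    (hR : R ∈ regions L) (hRσ : R ⊆ σ.strip T) {i : ℤ}
    (hi : ∀ q ∈ Ioo (s i) (s (i + 1)), pt T q ∉ L) {q : ℝ} (hq : q ∈ Ioo (s i) (s (i + 1)))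
    (h : pt T q ∈ closure R) : segment T s i ⊆ closure R := by
  rintro _ ⟨x, hx, rfl⟩
  exact interval_subset_closure hΨ hR hRσ isPreconnected_Ioo
    (fun q hq => toFun_ne_zero hΨ (hi q hq)) hq h x hx

theorem exists_touching (hs : IsEnumeration L n s) (hΨ : Ψ.Straightens L) (σ : Side) (i : ℤ) :
    ∃ R ∈ regions L, R ⊆ σ.strip T ∧ segment T s i ⊆ closure R := by
  obtain ⟨q, hq⟩ := exists_between (hs.lt_succ i)
  obtain ⟨R, hR, hRσ, h⟩ := exists_region_at hΨ σ (z := (q, 0)) σ.zero_mem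
    (toFun_ne_zero hΨ (hs.pt_notMem hq))
  exact ⟨R, hR, hRσ, segment_subset_closure hΨ hR hRσ (fun _ => hs.pt_notMem) hq h⟩

theorem exists_joins (hs : IsEnumeration L n s) (hΨ : Ψ.Straightens L) {σ : Side} {i : ℤ}
    {R : Set (Cyl T)} (hR : R ∈ regions L) (hRσ : R ⊆ σ.strip T)
    (h : segment T s i ⊆ closure R) : ∃ R', Joins L s σ i R R' := by
  obtain ⟨R', hR', hRσ', h'⟩ := exists_touching hs hΨ σ.opp i
  exact ⟨R', joins_iff.2 ⟨hR, hR', hRσ, hRσ', h, h'⟩⟩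

/-- The hypotheses concern the single segment `i`, because the lemma is also applied to `L'`, for
which `s` is no longer an enumeration. -/
theorem touching_unique (hΨ : Ψ.Straightens L) {σ : Side} {i : ℤ} (hi : s i < s (i + 1))
    (hiL : ∀ q ∈ Ioo (s i) (s (i + 1)), pt T q ∉ L)
    {R₁ R₂ : Set (Cyl T)} (h₁ : R₁ ∈ regions L) (h₂ : R₂ ∈ regions L) (hσ₁ : R₁ ⊆ σ.strip T)
    (hσ₂ : R₂ ⊆ σ.strip T) (ht₁ : segment T s i ⊆ closure R₁)
    (ht₂ : segment T s i ⊆ closure R₂) : R₁ = R₂ := by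
  obtain ⟨q, hq⟩ := exists_between hi
  exact region_unique hΨ (z := (q, 0)) σ.zero_mem (toFun_ne_zero hΨ (hiL q hq)) h₁ h₂ hσ₁ hσ₂
    (ht₁ ⟨q, hq, rfl⟩) (ht₂ ⟨q, hq, rfl⟩)

theorem strip_disjoint {σ : Side} {R : Set (Cyl T)} (hR : R ∈ regions L)
    (h : R ⊆ σ.strip T) (h' : R ⊆ σ.opp.strip T) : False := by
  obtain ⟨x, hx⟩ := nonempty_of_mem_regions hR
  exact Side.disjoint_strip (h hx) (h' hx)

/-- The regions at a segment and at the next one, on the same side of the zero section, are on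
different sides of `L`, so no chain of two edges leads from one to the other. -/
theorem ne_of_path (hs : IsEnumeration L n s) (hΨ : Ψ.Straightens L)
    (ht : Transverse (zeroSection T) L) {j k : ℤ} {a w b : Set (Cyl T)} (ha : a ∈ regions L)
    (hw : w ∈ regions L) (haj : segment T s j ⊆ closure a) (hak : segment T s k ⊆ closure a)
    (hwk : segment T s k ⊆ closure w) (hbj : segment T s (j - 1) ⊆ closure b) : w ≠ b := by
  rintro rfl
  obtain ⟨e, he, hea⟩ := exists_sign_of_region hΨ ha
  obtain ⟨f, hf, hfw⟩ := exists_sign_of_region hΨ hw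
  have pos : ∀ {i : ℤ} {R : Set (Cyl T)} {e : ℝ}, e ≠ 0 →
      (∀ z, proj T z ∈ closure R → 0 ≤ e * (Ψ.toFun z).2) → segment T s i ⊆ closure R →
      ∀ q ∈ Ioo (s i) (s (i + 1)), 0 < e * (Ψ.toFun (q, 0)).2 := by
    intro i R e he h hi q hq
    refine (h (q, 0) (hi ⟨q, hq, rfl⟩)).lt_of_ne' ?_
    exact mul_ne_zero he (toFun_ne_zero hΨ (hs.pt_notMem hq))
  obtain ⟨q, hq⟩ := exists_between (hs.lt_succ k)
  have h1 := pos he hea hak q hq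
  have h2 := pos hf hfw hwk q hq
  -- The segment `k` is common to `a` and `w`, so both lie on the same side of `L`.
  have hef : 0 < e * f := by
    have h3 : 0 < (e * f) * (Ψ.toFun (q, 0)).2 ^ 2 := by nlinarith [mul_pos h1 h2]
    exact pos_of_mul_pos_left h3 (sq_nonneg _)
  -- Then the segments `j - 1`, at `w`, and `j`, at `a`, are on the same side of `L`, although `L₀`
  -- crosses `L` at `s j`.
  refine ht.not_same_sign hΨ (hs.pt_mem j) (hs.strictMono (sub_one_lt j)) (hs.lt_succ j) e he
    ?_ (pos he hea haj)
  intro x hx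
  have h3 := pos hf hfw hbj x (by rwa [sub_add_cancel])
  have h4 : 0 < f ^ 2 * (e * (Ψ.toFun (x, 0)).2) := by nlinarith [mul_pos hef h3]
  exact pos_of_mul_pos_right h4 (sq_nonneg _)

end joins

/-! ### Integrals over the segments of the zero section. -/

section edge_integrals

variable {T : ℝ} {Ψ : ExactLift T}

theorem integral_dens (Ψ : ExactLift T) (a b : ℝ) :
    ∫ q in a..b, Ψ.dens q = Ψ.prim (b, 0) - Ψ.prim (a, 0) :=
  intervalIntegral.integral_eq_sub_of_hasDerivAt (fun q _ => Ψ.hasDerivAt_prim q)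
    (Ψ.continuous_dens.intervalIntegrable _ _)

theorem integral_indicator_of_forall_mem {f : ℝ → ℝ} {A : Set ℝ} {a b : ℝ} (hab : a ≤ b)
    (h : ∀ q ∈ Ioo a b, q ∈ A) : ∫ q in a..b, A.indicator f q = ∫ q in a..b, f q := by
  rw [intervalIntegral.integral_of_le hab, intervalIntegral.integral_of_le hab,
    integral_Ioc_eq_integral_Ioo, integral_Ioc_eq_integral_Ioo]
  exact setIntegral_congr_fun measurableSet_Ioo fun q hq => indicator_of_mem (h q hq) f

theorem integral_indicator_of_forall_notMem {f : ℝ → ℝ} {A : Set ℝ} {a b : ℝ} (hab : a ≤ b)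
    (h : ∀ q ∈ Ioo a b, q ∉ A) : ∫ q in a..b, A.indicator f q = 0 := by
  rw [intervalIntegral.integral_of_le hab, integral_Ioc_eq_integral_Ioo]
  exact setIntegral_eq_zero_of_forall_eq_zero fun q hq => indicator_of_notMem (h q hq) f

theorem intervalIntegrable_indicator {f : ℝ → ℝ} (hf : Continuous f) {A : Set ℝ}
    (hA : MeasurableSet A) (a b : ℝ) : IntervalIntegrable (A.indicator f) volume a b := by
  rw [intervalIntegrable_iff]
  exact ((hf.intervalIntegrable a b).def').indicator hA

theorem measurableSet_touching (R : Set (Cyl T)) : MeasurableSet (pt T ⁻¹' closure R) :=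
  (isClosed_closure.preimage ((continuous_proj T).comp (by fun_prop))).measurableSet

theorem integral_period_eq_sum {L : Set (Cyl T)} {n : ℕ} {s : ℤ → ℝ} (hs : IsEnumeration L n s)
    (Ψ : ExactLift T) (R : Set (Cyl T)) (i : ℤ) :
    ∫ q in s i..s i + T, (pt T ⁻¹' closure R).indicator Ψ.dens q
      = ∑ m ∈ Finset.range (2 * n), ∫ q in s (i + m)..s (i + m + 1),
        (pt T ⁻¹' closure R).indicator Ψ.dens q := by
  have h1 := intervalIntegral.sum_integral_adjacent_intervals (n := 2 * n) (μ := volume)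
    (f := (pt T ⁻¹' closure R).indicator Ψ.dens) (a := fun m : ℕ => s (i + m))
    (fun m _ => intervalIntegrable_indicator Ψ.continuous_dens (measurableSet_touching R) _ _)
  have h2 : s (i + ((2 * n : ℕ) : ℤ)) = s i + T := by
    rw [← hs.periodic]; push_cast; rfl
  simp only [h2, Nat.cast_zero, add_zero] at h1
  rw [← h1]
  refine Finset.sum_congr rfl fun m _ => ?_
  push_cast
  rw [add_assoc]

/-- On an interval of the zero section that is fixed by the diffeomorphism, the pullback of `λ`
does not change. -/
theorem dens_comp_symm_eq (hT : 0 < T) (Ψ : ExactLift T) {Λ : ExactLift T} {φ : Cyl T → Cyl T}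
    (hΛ : ∀ z, φ (proj T z) = proj T (Λ.toFun z)) {a b : ℝ}
    (hfix : ∀ q ∈ Ioo a b, φ (pt T q) = pt T q) {q : ℝ} (hq : q ∈ Ioo a b) :
    (Ψ.comp Λ.symm).dens q = Ψ.dens q := by
  have hinv : ∀ x ∈ Ioo a b, ∃ m : ℤ, Λ.invFun (x, 0) = (x, 0) + (m * T, 0) := by
    intro x hx
    have h1 := hfix x hx
    rw [pt, hΛ, proj_eq_iff] at h1
    obtain ⟨m, hm⟩ := h1
    refine ⟨m, ?_⟩
    rw [hm, Λ.invFun_add, Λ.left_inv]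
    rw [← hm]
  obtain ⟨m, hm⟩ := hinv q hq
  have hcont : Continuous fun x : ℝ => (Λ.invFun (x, 0)).1 - x :=
    (continuous_fst.comp (Λ.symm.continuous_toFun.comp (by fun_prop))).sub continuous_id
  -- A fixed point of `φ` is moved by the lift through some multiple of `T`, which might depend on
  -- the point. By continuity it is locally constant, since different multiples are at least `T`
  -- apart; a constant translation does not affect the density.
  have hev : ∀ᶠ x in 𝓝 q, (Ψ.comp Λ.symm).toFun (x, 0) = Ψ.toFun (x, 0) + (m * T, 0) := by
    have h1 := Metric.continuousAt_iff'.1 (hcont.continuousAt (x := q)) T hT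
    filter_upwards [h1, Ioo_mem_nhds hq.1 hq.2] with x hx hxJ
    obtain ⟨l, hl⟩ := hinv x hxJ
    rw [hl, hm, Real.dist_eq] at hx
    have h2 : |((l - m : ℤ) : ℝ)| * T < 1 * T := by
      rw [one_mul]
      refine lt_of_eq_of_lt ?_ hx
      rw [← abs_of_pos hT, ← abs_mul, abs_of_pos hT]
      congr 1
      simp
      ring
    have h3 := lt_of_mul_lt_mul_right h2 hT.le
    have h4 : l = m := by
      rw [← Int.cast_abs] at h3
      have : |l - m| < 1 := by exact_mod_cast h3
      have := Int.abs_lt_one_iff.1 this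
      omega
    change Ψ.toFun (Λ.invFun (x, 0)) = _
    rw [hl, h4, Ψ.toFun_add]
  have hd : ∀ Ξ : ExactLift T, HasDerivAt (fun x => Ξ.toFun (x, 0))
      (fderiv ℝ Ξ.toFun (q, 0) (1, 0)) q := fun Ξ =>
    (Ξ.hasFDerivAt (q, 0)).comp_hasDerivAt q (hasDerivAt_line q 0)
  have h1 := ((hd Ψ).add_const ((m * T, 0) : ℝ × ℝ)).congr_of_eventuallyEq hev
  rw [dens, dens, (hd (Ψ.comp Λ.symm)).unique h1, hev.self_of_nhds]
  simp

end edge_integrals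

/-! ### One root on each side. -/

section roots

variable {T : ℝ} {L : Set (Cyl T)} {Ψ : ExactLift T} {n : ℕ} {s : ℤ → ℝ}

theorem exists_root (hΨ : Ψ.Straightens L) (σ : Side) :
    ∃ R ∈ regions L, R ⊆ σ.strip T ∧ IsRoot R := by
  obtain ⟨c, hc0, hc1, hc⟩ := Ψ.eq_self
  have h : (Ψ.toFun (0, σ.sgn)).2 ≠ 0 := by
    rw [hc (0, σ.sgn) (by simpa [σ.abs_sgn] using hc1)]
    cases σ <;> simp [Side.sgn]
  obtain ⟨R, hR, hRσ, hR'⟩ := exists_region_at hΨ σ (z := (0, σ.sgn)) σ.sgn_mem h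
  exact ⟨R, hR, hRσ, isRoot_of_mem_closure hR'⟩

theorem root_unique (hΨ : Ψ.Straightens L) {σ : Side} {R₁ R₂ : Set (Cyl T)}
    (h₁ : R₁ ∈ regions L) (h₂ : R₂ ∈ regions L) (hσ₁ : R₁ ⊆ σ.strip T)
    (hσ₂ : R₂ ⊆ σ.strip T) (hr₁ : IsRoot R₁) (hr₂ : IsRoot R₂) : R₁ = R₂ := by
  obtain ⟨c, hc0, hc1, hc⟩ := Ψ.eq_self
  obtain ⟨t, ht, ht1⟩ := exists_between hc1
  exact regions_eq_of_nonempty h₁ h₂ ⟨proj T (0, σ.sgn * t),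
    collar_subset_of_isRoot hΨ h₁ hσ₁ hr₁ hc0 hc1 hc ht ht1 0,
    collar_subset_of_isRoot hΨ h₂ hσ₂ hr₂ hc0 hc1 hc ht ht1 0⟩

theorem volume_strip [Fact (0 < T)] (σ : Side) : volume (σ.strip T) = ENNReal.ofReal T := by
  have h1 : σ.strip T = (univ : Set (AddCircle T)) ×ˢ Ioo σ.lo σ.hi := by
    ext x; simp [Side.strip]
  rw [h1, Measure.volume_eq_prod, Measure.prod_prod, AddCircle.measure_univ, Real.volume_Ioo]
  cases σ <;> simp [Side.lo, Side.hi]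

/-- If another region lies on the same side, then a root has an edge. -/
theorem exists_segment_of_isRoot [Fact (0 < T)] (hs : IsEnumeration L n s) (hΨ : Ψ.Straightens L) {σ : Side}
    {R v : Set (Cyl T)} (hR : R ∈ regions L) (hRσ : R ⊆ σ.strip T) (hroot : IsRoot R)
    (hv : v ∈ regions L) (hvσ : v ⊆ σ.strip T) (hne : R ≠ v) :
    ∃ i, segment T s i ⊆ closure R := by
  by_contra! hno
  have hT : 0 < T := Fact.out
  -- With no segment on its boundary, the root would have the area `T` of the whole strip and leave
  -- no room for `v`.
  have harea : area R = T := by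
    rw [area_eq hΨ hR hRσ (s 0), integral_period_eq_sum hs, Finset.sum_eq_zero]
    · simp [hroot]
    · intro m _
      refine integral_indicator_of_forall_notMem (hs.lt_succ _).le fun q hq hq' => ?_
      exact hno _ (segment_subset_closure hΨ hR hRσ (fun _ => hs.pt_notMem) hq hq')
  have hvo := isOpen_of_mem_regions hΨ.isClosed hv
  have hpos : 0 < volume v := hvo.measure_pos volume (nonempty_of_mem_regions hv)
  have hdisj : Disjoint R v :=
    disjoint_iff_inter_eq_empty.2 <| not_nonempty_iff_eq_empty.1 fun h =>
      hne (regions_eq_of_nonempty hR hv h)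
  have hle : volume R + volume v ≤ ENNReal.ofReal T := by
    rw [← measure_union hdisj hvo.measurableSet, ← volume_strip σ]
    exact measure_mono (union_subset hRσ hvσ)
  have hRfin : volume R ≠ ⊤ :=
    ((le_self_add.trans hle).trans_lt ENNReal.ofReal_lt_top).ne
  have hRT : volume R = ENNReal.ofReal T :=
    (ENNReal.ofReal_toReal hRfin).symm.trans (congrArg ENNReal.ofReal harea)
  rw [hRT] at hle
  have : ENNReal.ofReal T < ENNReal.ofReal T + volume v :=
    ENNReal.lt_add_right ENNReal.ofReal_ne_top hpos.ne'
  exact absurd hle (not_le.2 this)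

end roots

/-! ### Effect of the deletion on segments, roots and areas. -/

namespace RemovesLeaf

variable {T : ℝ} {L L' : Set (Cyl T)} {n : ℕ} {s : ℤ → ℝ} {σ : Side} {j : ℤ} {v : Set (Cyl T)}
  {F : Set (Cyl T) → Set (Cyl T)}

theorem joins (hF : RemovesLeaf L L' n s σ j v F) {i : ℤ} (hi : ¬ i ≡ j [ZMOD 2 * n])
    {R R' : Set (Cyl T)} (h : Joins L s σ i R R') : Joins L' s σ i (F R) (F R') := by
  cases σ
  · exact hF.edges i hi _ _ h
  · exact hF.edges i hi _ _ h

/-- The only regions that `F` merges lie across the zero section from the leaf. -/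
theorem injective_on_side (hF : RemovesLeaf L L' n s σ j v F) {R R' : Set (Cyl T)}
    (hR : R ∈ regions L) (hR' : R' ∈ regions L) (hv : R ≠ v) (hv' : R' ≠ v)
    (hσ : R ⊆ σ.strip T) (h : F R = F R') : R = R' := by
  obtain ⟨b, b₁, b₂, h₁, h₂, hm⟩ := hF.merge
  rw [joins_iff] at h₁ h₂
  rcases (hm R ⟨hR, hv⟩ R' ⟨hR', hv'⟩).1 h with h | ⟨rfl, -⟩ | ⟨rfl, -⟩
  · exact h
  · exact (strip_disjoint hR hσ h₁.2.2.2.1).elim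
  · exact (strip_disjoint hR hσ h₂.2.2.2.1).elim

end RemovesLeaf

namespace IsLeaf

variable {T : ℝ} {L : Set (Cyl T)} {Ψ : ExactLift T} {n : ℕ} {s : ℤ → ℝ} {σ : Side} {j : ℤ}
  {v R : Set (Cyl T)}

theorem ne_of_segment (hv : IsLeaf L n s σ j v) (hs : IsEnumeration L n s)
    (hΨ : Ψ.Straightens L) (hR : R ∈ regions L) (hRσ : R ⊆ σ.strip T) {i : ℤ}
    (hi : ¬ i ≡ j [ZMOD 2 * n]) (h : segment T s i ⊆ closure R) : R ≠ v := by
  rintro rfl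
  obtain ⟨R', hR'⟩ := exists_joins hs hΨ hR hRσ h
  exact hi (hv.unique i R' hR')

end IsLeaf

/-- The graph of the new curve sees the same segments at a region as the old one. -/
theorem RemovesLeaf.segment_iff {T : ℝ} {L L' : Set (Cyl T)} {n : ℕ} {s : ℤ → ℝ} {σ : Side} {j : ℤ}
    {v w : Set (Cyl T)} {F : Set (Cyl T) → Set (Cyl T)} {Ψ Ψ' : ExactLift T}
    (hF : RemovesLeaf L L' n s σ j v F) (hv : IsLeaf L n s σ j v) (hs : IsEnumeration L n s)
    (hΨ : Ψ.Straightens L) (hΨ' : Ψ'.Straightens L') (hL' : ∀ q, pt T q ∈ L' → pt T q ∈ L)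
    (hw : w ∈ regions L) (hwσ : w ⊆ σ.strip T) (hwv : w ≠ v) (hFσ : F w ⊆ σ.strip T) {i : ℤ}
    (hi : ¬ i ≡ j [ZMOD 2 * n]) :
    segment T s i ⊆ closure (F w) ↔ segment T s i ⊆ closure w := by
  constructor
  · intro h
    -- Edges are only known to be carried forward by `F`. For the converse, the region `R` of `L` at
    -- this segment has an image touching it, so `F R = F w` by uniqueness, and `R = w` by
    -- injectivity on the side.
    obtain ⟨R, hR, hRσ, hRi⟩ := exists_touching hs hΨ σ i
    have hRv := hv.ne_of_segment hs hΨ hR hRσ hi hRi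
    obtain ⟨R', hRR'⟩ := exists_joins hs hΨ hR hRσ hRi
    obtain ⟨h1, -, h3, -, h5, -⟩ := joins_iff.1 (hF.joins hi hRR')
    have h6 := touching_unique hΨ' (hs.lt_succ i) (fun q hq hq' => hs.pt_notMem hq (hL' q hq'))
      h1 (hF.mapsTo ⟨hw, hwv⟩) h3 hFσ h5 h
    rwa [← hF.injective_on_side hR hw hRv hwv hRσ h6]
  · intro h
    obtain ⟨R', hR'⟩ := exists_joins hs hΨ hw hwσ h
    exact (joins_iff.1 (hF.joins hi hR')).2.2.2.2.1

/-- Roots too are only carried forward. For the converse, the old root on this side is compared with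
`w`: its image and `F w` are both roots on the same side, hence equal. That its image stays on this
side is known only through an edge, which is why the root must be shown to have one. -/
theorem RemovesLeaf.isRoot_iff {T : ℝ} [Fact (0 < T)] {L L' : Set (Cyl T)} {n : ℕ} {s : ℤ → ℝ}
    {σ : Side} {j : ℤ} {v w : Set (Cyl T)} {F : Set (Cyl T) → Set (Cyl T)} {Ψ Ψ' : ExactLift T}
    (hF : RemovesLeaf L L' n s σ j v F) (hv : IsLeaf L n s σ j v) (hs : IsEnumeration L n s)
    (hΨ : Ψ.Straightens L) (hΨ' : Ψ'.Straightens L')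
    (hw : w ∈ regions L) (hwv : w ≠ v) (hFσ : F w ⊆ σ.strip T) :
    IsRoot (F w) ↔ IsRoot w := by
  refine ⟨fun h => ?_, fun h => hF.roots w ⟨hw, hwv⟩ h⟩
  obtain ⟨a, ha⟩ := hv.edge
  obtain ⟨hvR, -, hvσ, -, hvj, -⟩ := joins_iff.1 ha
  obtain ⟨R, hR, hRσ, hroot⟩ := exists_root hΨ σ
  have hRv : R ≠ v := by rintro rfl; exact hv.not_root hroot
  obtain ⟨i, hi⟩ := exists_segment_of_isRoot hs hΨ hR hRσ hroot hvR hvσ hRv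
  have hij : ¬ i ≡ j [ZMOD 2 * n] := by
    intro h
    obtain ⟨m, hm⟩ := h.symm.dvd
    have h2 : segment T s i = segment T s j := by
      rw [← hs.segment_add_period j m]
      congr 1
      linarith
    rw [h2] at hi
    exact hRv (touching_unique hΨ (hs.lt_succ j) (fun _ => hs.pt_notMem) hR hvR hRσ hvσ hi hvj)
  obtain ⟨R', hR'⟩ := exists_joins hs hΨ hR hRσ hi
  obtain ⟨h1, -, h3, -⟩ := joins_iff.1 (hF.joins hij hR')
  have h4 := root_unique hΨ' h1 (hF.mapsTo ⟨hw, hwv⟩) h3 hFσ (hF.roots R ⟨hR, hRv⟩ hroot) h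
  rwa [← hF.injective_on_side hR hw hRv hwv hRσ h4]

/-- The change of the area of `w` is the jump of the difference of the primitives across the
segment `k`. -/
theorem IsLeafDeletion.exists_prim_jump {T : ℝ} [Fact (0 < T)] {L : Set (Cyl T)} {n : ℕ}
    {s : ℤ → ℝ} {σ : Side} {j k : ℤ} {v w : Set (Cyl T)} {ε : ℝ} {φ : Cyl T → Cyl T}
    {Ψ : ExactLift T} (hΨ : Ψ.Straightens L) (ht : Transverse (zeroSection T) L)
    (hs : IsEnumeration L n s) (hj : 1 ≤ j) (hjk : j + 2 ≤ k) (hk : k ≤ 2 * n)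
    (hφ : IsLeafDeletion L n s σ j k v w ε φ) :
    ∃ Ψ' : ExactLift T, Ψ'.Straightens (φ '' L) ∧ ∃ D : ℤ → ℝ,
      (∀ i, D i = Ψ'.prim (s i, 0) - Ψ.prim (s i, 0)) ∧
      (∀ i, j + 2 ≤ i → i ≤ j + 2 * n - 2 → i ≠ k → D (i + 1) = D i) ∧
      σ.sgn * (D k - D (k + 1)) = area v + ε := by
  have hT : 0 < T := Fact.out
  obtain ⟨Λ, hΛ⟩ := hφ.isHamDiffeo.exists_exactLift hT
  set Ψ' := Ψ.comp Λ.symm with hΨ'd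
  have hΨ' : Ψ'.Straightens (φ '' L) := hΨ.image hΛ
  obtain ⟨a, hva, hwa⟩ := hφ.path
  obtain ⟨F, hF, harea⟩ := hφ.graph
  have hv := hφ.isLeaf
  obtain ⟨hwR, haR, hwσ, haσ, hwk, hak⟩ := joins_iff.1 hwa
  obtain ⟨hvR, -, hvσ, -, hvj, haj⟩ := joins_iff.1 hva
  have hmod : ∀ i : ℤ, j < i → i < j + 2 * n → ¬ i ≡ j [ZMOD 2 * n] := by
    intro i h1 h2 h3
    obtain ⟨m, hm⟩ := h3.symm.dvd
    have h4 : 0 < m := by by_contra! h; nlinarith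
    nlinarith
  have hmodk : ¬ k ≡ j [ZMOD 2 * n] := hmod k (by omega) (by omega)
  have hmod1 : ¬ (j - 1) ≡ j [ZMOD 2 * n] := by
    intro h
    refine hmod (j - 1 + 2 * n) (by omega) (by omega) ?_
    exact (Int.modEq_iff_dvd.2 ⟨-1, by ring⟩ : j - 1 + 2 * n ≡ j - 1 [ZMOD 2 * n]).trans h
  have hwv : w ≠ v := hv.ne_of_segment hs hΨ hwR hwσ hmodk hwk
  have hFR : F w ∈ regions (φ '' L) := hF.mapsTo ⟨hwR, hwv⟩
  have hFσ : F w ⊆ σ.strip T := (joins_iff.1 (hF.joins hmodk hwa)).2.2.1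
  have hmemL' : ∀ q, pt T q ∈ φ '' L ↔ pt T q ∈ L ∧ pt T q ≠ pt T (s j) ∧
      pt T q ≠ pt T (s (j + 1)) := by
    intro q
    have h1 := Set.ext_iff.1 hφ.inter_eq (pt T q)
    simpa [pt_mem_zeroSection] using h1
  have hL' : ∀ q, pt T q ∈ φ '' L → pt T q ∈ L := fun q h => ((hmemL' q).1 h).1
  have hseg : ∀ i, ¬ i ≡ j [ZMOD 2 * n] →
      (segment T s i ⊆ closure (F w) ↔ segment T s i ⊆ closure w) := fun i hi =>
    hF.segment_iff hv hs hΨ hΨ' hL' hwR hwσ hwv hFσ hi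
  have hw1 : ¬ segment T s (j - 1) ⊆ closure w := by
    intro h
    obtain ⟨b, b₁, b₂, h₁, -, -⟩ := hF.merge
    obtain ⟨hbR, -, hbσ, -, hbj, -⟩ := joins_iff.1 h₁
    exact ne_of_path hs hΨ ht haR hwR haj hak hwk hbj
      (touching_unique hΨ (hs.lt_succ _) (fun _ => hs.pt_notMem) hwR hbR hwσ hbσ h hbj)
  have hw2 : ¬ segment T s (j + 1) ⊆ closure w := by
    intro h
    obtain ⟨b, b₁, b₂, h₁, h₂, -⟩ := hF.merge
    obtain ⟨hbR, -, hbσ, -, hbj, -⟩ := joins_iff.1 h₁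
    obtain ⟨-, -, -, -, hbj', -⟩ := joins_iff.1 h₂
    exact ne_of_path hs hΨ ht haR hwR haj hak hwk hbj
      (touching_unique hΨ (hs.lt_succ _) (fun _ => hs.pt_notMem) hwR hbR hwσ hbσ h hbj')
  have hw0 : ¬ segment T s j ⊆ closure w := fun h =>
    hwv (touching_unique hΨ (hs.lt_succ _) (fun _ => hs.pt_notMem) hwR hvR hwσ hvσ h hvj)
  -- near the leaf, the new region `F w` does not touch the zero section
  have hgap : ∀ q ∈ Ioo (s (j - 1)) (s (j + 2)), pt T q ∉ φ '' L := by
    intro q hq h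
    obtain ⟨h1, h2, h3⟩ := (hmemL' q).1 h
    obtain ⟨i, rfl⟩ := (hs.pt_mem_iff q).1 h1
    have h4 := hs.strictMono.lt_iff_lt.1 hq.1
    have h5 := hs.strictMono.lt_iff_lt.1 hq.2
    have h6 : i = j ∨ i = j + 1 := by omega
    rcases h6 with rfl | rfl
    · exact h2 rfl
    · exact h3 rfl
  have hFgap : ∀ q ∈ Ioo (s (j - 1)) (s (j + 2)), pt T q ∉ closure (F w) := by
    intro q hq h
    -- For `L'` the gap is a single interval without intersection points, so contact anywhere in it
    -- spreads to the segment `j - 1`, to which `hseg` applies; it does not apply to `j`.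
    have h1 := interval_subset_closure hΨ' hFR hFσ isPreconnected_Ioo
      (fun x hx => toFun_ne_zero hΨ' (hgap x hx)) hq h
    refine hw1 ((hseg _ hmod1).1 ?_)
    rintro _ ⟨x, hx, rfl⟩
    rw [sub_add_cancel] at hx
    exact h1 x ⟨hx.1, hx.2.trans (hs.strictMono (by omega))⟩
  -- The bounds on `j` and `k` leave one exception, `j = 1` and `k = 2n`. There the segment `k`
  -- would be the segment `j - 1`, which `w` does not touch.
  have hkj : k ≤ j + 2 * n - 2 := by
    by_contra! h
    have h1 : k = (j - 1) + 2 * n * 1 := by omega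
    rw [h1, hs.segment_add_period] at hwk
    exact hw1 hwk
  set D : ℤ → ℝ := fun i => Ψ'.prim (s i, 0) - Ψ.prim (s i, 0) with hD
  have hDint : ∀ i, D (i + 1) - D i = (∫ q in s i..s (i + 1), Ψ'.dens q)
      - ∫ q in s i..s (i + 1), Ψ.dens q := by
    intro i
    rw [integral_dens, integral_dens]
    simp only [hD]
    ring
  have hDfix : ∀ i, j + 2 ≤ i → i ≤ j + 2 * n - 2 → i ≠ k → D (i + 1) = D i := by
    intro i h1 h2 hik
    rw [← sub_eq_zero, hDint, sub_eq_zero, intervalIntegral.integral_of_le (hs.lt_succ i).le,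
      intervalIntegral.integral_of_le (hs.lt_succ i).le, integral_Ioc_eq_integral_Ioo,
      integral_Ioc_eq_integral_Ioo]
    refine setIntegral_congr_fun measurableSet_Ioo fun q hq => ?_
    refine dens_comp_symm_eq hT Ψ hΛ (fun x hx => ?_) hq
    by_contra hne
    obtain ⟨y, hy, hyx⟩ := hφ.support x hne
    obtain ⟨m, rfl⟩ := pt_eq_pt_iff.1 hyx
    -- The support is given on the circle, so on the line it is known up to `m` periods. Comparing
    -- indices excludes every translate of the interval around the leaf, and forces `m = 0` and `i =
    -- k` for the other one.
    have hidx : ∀ p r : ℤ, y ∈ Ioo (s p) (s r) → p + 2 * n * m < i + 1 ∧ i < r + 2 * n * m := by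
      intro p r hy
      constructor
      · refine hs.strictMono.lt_iff_lt.1 ?_
        rw [hs.add_period]
        linarith [hx.2, hy.1]
      · refine hs.strictMono.lt_iff_lt.1 ?_
        rw [hs.add_period]
        linarith [hx.1, hy.2]
    rcases hy with hy | hy
    · obtain ⟨h3, h4⟩ := hidx _ _ hy
      have h5 : 0 < m := by by_contra! h; nlinarith
      nlinarith
    · obtain ⟨h3, h4⟩ := hidx _ _ hy
      have h5 : m < 1 := by by_contra! h; nlinarith
      have h6 : -1 < m := by by_contra! h; nlinarith
      obtain rfl : m = 0 := by omega
      omega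
  refine ⟨Ψ', hΨ', D, fun i => rfl, hDfix, ?_⟩
  -- The period starts at `s (j - 1)`, so that the three segments at the leaf come first. They
  -- contribute to neither area, and every later segment except `k` contributes equally to both.
  have hA' := area_eq hΨ' hFR hFσ (s (j - 1))
  have hA := area_eq hΨ hwR hwσ (s (j - 1))
  rw [integral_period_eq_sum hs] at hA hA'
  have hr : IsRoot (F w) ↔ IsRoot w := hF.isRoot_iff hv hs hΨ hΨ' hwR hwv hFσ
  have hsum : (∑ m ∈ Finset.range (2 * n), ∫ q in s (j - 1 + m)..s (j - 1 + m + 1),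
        (pt T ⁻¹' closure (F w)).indicator Ψ'.dens q)
      - ∑ m ∈ Finset.range (2 * n), ∫ q in s (j - 1 + m)..s (j - 1 + m + 1),
        (pt T ⁻¹' closure w).indicator Ψ.dens q = D (k + 1) - D k := by
    have hzero : ∀ (Ξ : ExactLift T) (R : Set (Cyl T)) (i : ℤ),
        (∀ q ∈ Ioo (s i) (s (i + 1)), pt T q ∉ closure R) →
        ∫ q in s i..s (i + 1), (pt T ⁻¹' closure R).indicator Ξ.dens q = 0 := fun Ξ R i h =>
      integral_indicator_of_forall_notMem (hs.lt_succ i).le h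
    have hfull : ∀ (Ξ : ExactLift T) (R : Set (Cyl T)) (i : ℤ), segment T s i ⊆ closure R →
        ∫ q in s i..s (i + 1), (pt T ⁻¹' closure R).indicator Ξ.dens q
          = ∫ q in s i..s (i + 1), Ξ.dens q := fun Ξ R i h =>
      integral_indicator_of_forall_mem (hs.lt_succ i).le fun q hq => h ⟨q, hq, rfl⟩
    have hnone : ∀ i, ¬ segment T s i ⊆ closure w →
        ∀ q ∈ Ioo (s i) (s (i + 1)), pt T q ∉ closure w := fun i hi q hq h =>
      hi (segment_subset_closure hΨ hwR hwσ (fun _ => hs.pt_notMem) hq h)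
    have hnone' : ∀ i, ¬ segment T s i ⊆ closure (F w) →
        ∀ q ∈ Ioo (s i) (s (i + 1)), pt T q ∉ closure (F w) := fun i hi q hq h =>
      hi (segment_subset_closure hΨ' hFR hFσ (fun q hq hq' => hs.pt_notMem hq (hL' q hq')) hq h)
    have hterm : ∀ i, j - 1 ≤ i → i ≤ j + 2 * n - 2 → i ≠ k →
        (∫ q in s i..s (i + 1), (pt T ⁻¹' closure (F w)).indicator Ψ'.dens q)
          - ∫ q in s i..s (i + 1), (pt T ⁻¹' closure w).indicator Ψ.dens q = 0 := by
      intro i h1 h2 hik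
      by_cases hi : i ≤ j + 1
      · have hiw : ¬ segment T s i ⊆ closure w := by
          have h3 : i = j - 1 ∨ i = j ∨ i = j + 1 := by omega
          rcases h3 with rfl | rfl | rfl
          · exact hw1
          · exact hw0
          · exact hw2
        rw [hzero _ _ _ (hnone i hiw), hzero, sub_zero]
        intro q hq
        refine hFgap q ⟨lt_of_le_of_lt ?_ hq.1, lt_of_lt_of_le hq.2 ?_⟩
        · exact hs.strictMono.monotone h1
        · exact hs.strictMono.monotone (by omega)
      · have hij := hmod i (by omega) (by omega)
        by_cases hiw : segment T s i ⊆ closure w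
        · rw [hfull _ _ _ hiw, hfull _ _ _ ((hseg i hij).2 hiw), ← hDint,
            hDfix i (by omega) h2 hik, sub_self]
        · rw [hzero _ _ _ (hnone i hiw),
            hzero _ _ _ (hnone' i fun h => hiw ((hseg i hij).1 h)), sub_zero]
    rw [← Finset.sum_sub_distrib, Finset.sum_eq_single (k - j + 1).toNat]
    · have h1 : j - 1 + ((k - j + 1).toNat : ℤ) = k := by omega
      rw [h1, hfull _ _ _ hwk, hfull _ _ _ ((hseg k hmodk).2 hwk), hDint]
    · intro m hm hmk
      rw [Finset.mem_range] at hm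
      exact hterm _ (by omega) (by omega) (by omega)
    · intro h
      rw [Finset.mem_range] at h
      omega
  rw [hA', hA] at harea
  by_cases hroot : IsRoot w
  · rw [if_pos hroot, if_pos (hr.2 hroot)] at harea
    linear_combination harea + σ.sgn * hsum
  rw [if_neg hroot, if_neg (mt hr.1 hroot)] at harea
  linear_combination harea + σ.sgn * hsum

end Cylinder

open Cylinder
-- The change of the actions.
theorem mainTheorem6 {T : ℝ} [Fact (0 < T)] (L : Set (Cyl T)) (hL : IsHamIsotopic L)
    (hLt : Transverse (zeroSection T) L) (n : ℕ) (s : ℤ → ℝ) (hs : IsEnumeration L n s)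
    (side : Side) (j k : ℤ) (hj : 1 ≤ j) (hjk : j + 2 ≤ k) (hk : k ≤ 2 * n)
    (v w : Set (Cyl T)) (ε : ℝ) (hε : 0 < ε) (φ : Cyl T → Cyl T)
    (hφ : IsLeafDeletion L n s side j k v w ε φ)
    (h₀ h h₀' h' : Cyl T → ℝ)
    (hh₀ : IsMarking (zeroSection T) h₀) (hh : IsMarking L h)
    (hh₀' : IsMarking (zeroSection T) h₀') (hh' : IsMarking (φ '' L) h') :
    ∃ c : ℝ,
      (side = Side.above → ∀ l : ℤ, 1 ≤ l → l ≤ 2 * n → l ≠ j → l ≠ j + 1 →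
        action h₀' h' (pt T (s l)) + c =
          if j + 2 ≤ l ∧ l ≤ k then action h₀ h (pt T (s l)) + (area v + ε) / 2
          else action h₀ h (pt T (s l)) - (area v + ε) / 2) ∧
      (side = Side.below → ∀ l : ℤ, 1 ≤ l → l ≤ 2 * n → l ≠ j → l ≠ j + 1 →
        action h₀' h' (pt T (s l)) + c =
          if j + 2 ≤ l ∧ l ≤ k then action h₀ h (pt T (s l)) - (area v + ε) / 2
          else action h₀ h (pt T (s l)) + (area v + ε) / 2) := by
  have hT : 0 < T := Fact.out
  obtain ⟨Ψ, hΨ⟩ := hL.exists_straightens hT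
  obtain ⟨Ψ', hΨ', D, hD, hfix, hjump⟩ := hφ.exists_prim_jump hΨ hLt hs hj hjk hk
  obtain ⟨C, hC⟩ := exists_action_eq hΨ hh₀ hh
  obtain ⟨C', hC'⟩ := exists_action_eq hΨ' hh₀' hh'
  have hact : ∀ l, j + 2 ≤ l → l ≤ j + 2 * n - 1 →
      action h₀' h' (pt T (s l)) = action h₀ h (pt T (s l)) + D l + (C' - C) := by
    intro l h1 h2
    have hmem : pt T (s l) ∈ φ '' L := by
      have h3 : pt T (s l) ∈ (zeroSection T ∩ L) \ {pt T (s j), pt T (s (j + 1))} := by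
        refine ⟨⟨pt_mem_zeroSection _, hs.pt_mem l⟩, ?_⟩
        rintro (h3 | h3)
        · obtain ⟨m, hm⟩ := hs.pt_s_eq_iff.1 h3.symm
          have h4 : 0 < m := by by_contra! h; nlinarith
          nlinarith
        · obtain ⟨m, hm⟩ := hs.pt_s_eq_iff.1 (Set.mem_singleton_iff.1 h3).symm
          have h4 : 0 < m := by by_contra! h; nlinarith
          nlinarith
      rw [← hφ.inter_eq] at h3
      exact h3.2
    rw [hC _ (hs.pt_mem l), hC' _ hmem, hD]
    ring
  -- The disjunction says that the segment `k`, the only one where `D` may jump in this range, is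
  -- not crossed.
  have hconst : ∀ (m : ℕ) (i : ℤ), j + 2 ≤ i → i + m ≤ j + 2 * n - 1 →
      (i + m ≤ k ∨ k + 1 ≤ i) → D (i + m) = D i := by
    intro m
    induction m with
    | zero => intro i _ _ _; simp
    | succ m ih =>
      intro i h1 h2 h3
      push_cast at h2 h3 ⊢
      rw [← add_assoc, hfix (i + m) (by omega) (by omega) (by omega),
        ih i h1 (by omega) (by omega)]
  have hval : ∀ l : ℤ, 1 ≤ l → l ≤ 2 * n → l ≠ j → l ≠ j + 1 →
      action h₀' h' (pt T (s l)) = action h₀ h (pt T (s l))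
        + (if j + 2 ≤ l ∧ l ≤ k then D k else D (k + 1)) + (C' - C) := by
    intro l h1 h2 h3 h4
    split_ifs with hl
    · rw [hact l hl.1 (by omega)]
      have h5 := hconst (k - l).toNat l hl.1 (by omega) (by omega)
      rw [show l + ((k - l).toNat : ℤ) = k by omega] at h5
      rw [h5]
    · by_cases hlk : k < l
      · rw [hact l (by omega) (by omega)]
        have h5 := hconst (l - (k + 1)).toNat (k + 1) (by omega) (by omega) (by omega)
        rw [show k + 1 + ((l - (k + 1)).toNat : ℤ) = l by omega] at h5
        rw [h5]
      · have h6 := hact (l + 2 * n * 1) (by omega) (by omega)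
        rw [hs.pt_add_period] at h6
        rw [h6]
        have h5 := hconst (l + 2 * n * 1 - (k + 1)).toNat (k + 1) (by omega) (by omega) (by omega)
        rw [show k + 1 + ((l + 2 * n * 1 - (k + 1)).toNat : ℤ) = l + 2 * n * 1 by omega] at h5
        rw [h5]
  -- Removing the marking constants and the mean of the two values of `D` leaves plus or minus half
  -- of the jump.
  refine ⟨-(C' - C) - (D k + D (k + 1)) / 2, ?_, ?_⟩
  · rintro rfl l h1 h2 h3 h4
    rw [hval l h1 h2 h3 h4]
    simp only [Side.sgn] at hjump
    split_ifs <;> linarith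
  · rintro rfl l h1 h2 h3 h4
    rw [hval l h1 h2 h3 h4]
    simp only [Side.sgn] at hjump
    split_ifs <;> linarith
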